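/- **Conventions.** An SKT Lie algebra is a triple $(\mathfrak g,g,J)$, where $\mathfrak g$ is a finite-dimensional real Lie algebra, $g$ is a Euclidean metric on $\mathfrak g$ and $J$ is a $g$-orthogonal integrable complex structure on $\mathfrak g$, such that the three-form $c=-J^*d\sigma$, $\sigma=g(J\cdot,\cdot)$, is closed. It is two-step solvable if $\mathfrak g'=[\mathfrak g,\mathfrak g]$ is Abelian; $\mathfrak g'$ is complex if $\mathfrak g'\cap J\mathfrak g'=\mathfrak g'$. Isomorphisms of such triples are isometric Lie algebra isomorphisms commuting with the complex structures. **The triples $\mathfrak g_{f,h,\alpha}$.** Let $\mathfrak a_J$ be a complex vector space with basis $Y_1,\dots,Y_m$, let $\mathfrak a_r$ be a finite-dimensional real vector space, and let $I_0\colon\mathfrak a_r\to U_r$ be an isomorphism onto a copy of $\mathfrak a_r$. Let $f\colon\mathfrak a_r\times\mathfrak a_r\to\mathfrak a_r$ be symmetric bilinear with $f(f(\cdot,\cdot),\cdot)$ totally symmetric, let $h=\sum_i h^iY_i\colon\mathfrak a_r\times\mathfrak a_r\to\mathfrak a_J$ be real bilinear with skew part $h_2(X,W)=\tfrac12(h(X,W)-h(W,X))$,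 and let $\alpha_1,\dots,\alpha_m\colon\mathfrak a_r\to\mathbb C$ be real linear. On $\mathfrak a_J\oplus\mathfrak a_r\oplus U_r$ take the skew bilinear bracket that vanishes on $\mathfrak a_J\oplus\mathfrak a_r$ and satisfies $$[I_0X,Y_i]=\alpha_i(X)Y_i,\quad [I_0X,W]=f(X,W)+h(X,W),\quad [I_0X,I_0W]=2i\,h_2(X,W)$$ for $X,W\in\mathfrak a_r$, complex linearly in the argument from $\mathfrak a_J$; the almost complex structure $I(Y+X+I_0Z)=iY-Z+I_0X$; and a Euclidean metric $\tilde g$ for which $Y_1,\dots,Y_m,iY_1,\dots,iY_m$ is an orthonormal basis of $\mathfrak a_J$, $\mathfrak a_J\perp\mathfrak a_r\oplus U_r$, and $\tilde g(X,W)=\tilde g(I_0X,I_0W)=g_0(X,W)$, $\tilde g(I_0X,W)=-\tilde g(X,I_0W)=\tau_0(X,W)$ for a symmetric form $g_0$ and a skew form $\tau_0$ on $\mathfrak a_r$ (any such forms making $\tilde g$ positive definite). The triple so obtained is denoted $\mathfrak g_{f,h,\alpha}$. **Theorem.** Let $(\mathfrak g,g,J)$ be a two-step solvable $2n$-dimensional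 SKT Lie algebra with $\mathfrak g'$ non-complex and of codimension two. Then $n\ge2$ and $(\mathfrak g,g,J)$ is isomorphic to some $\mathfrak g_{f,h,\alpha}$ with $m=n-2$, where $\mathfrak a_r$ has an orthonormal basis $(X_1,X_2)$ with $f(X_1,X_j)=aX_j$ for $j=1,2$ and $f(X_2,X_2)=b_1X_1+b_2X_2$ for certain $a>0$, $b_1\in\mathbb R$, $b_2\ge0$, where $$2a(a-b_1)+\|h(X_1,X_2)-h(X_2,X_1)\|^2+\|h(X_1,X_2)\|^2+\|h(X_2,X_1)\|^2-2\tilde g\bigl(h(X_1,X_1),h(X_2,X_2)\bigr)=0,$$ and where, for each $i=1,\dots,n-2$, the numbers $z_i=\alpha_i(X_1)$, $w_i=\alpha_i(X_2)\in\mathbb C$ satisfy one of the following: 1. $\operatorname{Re}z_i=0$, $\operatorname{Re}w_i=0$, $z_i\ne0$ and $$h^i(X_2,X_1)=h^i(X_1,X_2)=\frac{w_i}{z_i}h^i(X_1,X_1),\qquad h^i(X_2,X_2)=\frac{w_i^2-b_2w_i-b_1z_i}{z_i(z_i-a)}h^i(X_1,X_1);$$ 2. $z_i=0$, $\operatorname{Re}w_i=0$,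 $w_i\ne0$ and $$h^i(X_1,X_1)=0,\qquad h^i(X_2,X_1)=h^i(X_1,X_2),\qquad h^i(X_2,X_2)=\frac{b_2-w_i}{a}h^i(X_1,X_2);$$ 3. $\operatorname{Re}z_i=-a/2$, $x=\operatorname{Re}w_i$ solves $2x^2+b_2x-\tfrac{b_1}{2}a=0$ and $$h^i(X_1,X_2)=\frac{\overline{w}_i}{\overline{z}_i}h^i(X_1,X_1),\qquad h^i(X_2,X_1)=\frac{w_i\overline{z}_i-a\overline{w}_i}{|z_i|^2-a\overline{z}_i}h^i(X_1,X_1),$$ $$h^i(X_2,X_2)=\frac{|w_i|^2-b_1\overline{z}_i-b_2\overline{w}_i}{|z_i|^2-a\overline{z}_i}h^i(X_1,X_1).$$ The third case can only occur if $b_1\ge-b_2^2/(4a)$. Conversely, every such $\mathfrak g_{f,h,\alpha}$ is a $2n$-dimensional two-step solvable SKT Lie algebra with derived algebra non-complex and of codimension two. -/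

import Mathlib

open scoped ComplexConjugate

namespace SKT

section Geometry

variable {L : Type*} [LieRing L] [LieAlgebra ℝ L]

/-- The Chevalley–Eilenberg differential of a two-form. -/
def extDeriv₂ (β : L → L → ℝ) (x y z : L) : ℝ :=
  -β ⁅x, y⁆ z + β ⁅x, z⁆ y - β ⁅y, z⁆ x

/-- The Chevalley–Eilenberg differential of a three-form. -/
def extDeriv₃ (γ : L → L → L → ℝ) (x y z w : L) : ℝ :=
  -γ ⁅x, y⁆ z w + γ ⁅x, z⁆ y w - γ ⁅x, w⁆ y z
    - γ ⁅y, z⁆ x w + γ ⁅y, w⁆ x z - γ ⁅z, w⁆ x y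

/-- The fundamental two-form `σ = g(J·,·)`. -/
def fundamentalForm (g : LinearMap.BilinForm ℝ L) (J : L →ₗ[ℝ] L) (x y : L) : ℝ :=
  g (J x) y

/-- The torsion three-form `c = -J^* dσ`. -/
def torsionForm (g : LinearMap.BilinForm ℝ L) (J : L →ₗ[ℝ] L) (x y z : L) : ℝ :=
  -extDeriv₂ (fundamentalForm g J) (J x) (J y) (J z)

/-- `(g, J)` is a Hermitian structure on the Lie algebra `L`: `g` is a Euclidean metric and `J` is
a `g`-orthogonal integrable almost complex structure (vanishing Nijenhuis tensor). -/
structure IsHermitian (g : LinearMap.BilinForm ℝ L) (J : L →ₗ[ℝ] L) : Prop where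
  symm : ∀ x y, g x y = g y x
  pos : ∀ x, x ≠ 0 → 0 < g x x
  sq : ∀ x, J (J x) = -x
  orthogonal : ∀ x y, g (J x) (J y) = g x y
  integrable : ∀ x y, ⁅J x, J y⁆ - J ⁅J x, y⁆ - J ⁅x, J y⁆ - ⁅x, y⁆ = 0

/-- `(g, J)` is an SKT structure: Hermitian with closed torsion three-form. -/
structure IsSKT (g : LinearMap.BilinForm ℝ L) (J : L →ₗ[ℝ] L) : Prop
    extends IsHermitian g J where
  torsion_closed : ∀ x y z w, extDeriv₃ (torsionForm g J) x y z w = 0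

/-- A subspace `V` is complex if `V = V ∩ JV`. -/
def IsComplexSubspace (J : L →ₗ[ℝ] L) (V : Submodule ℝ L) : Prop :=
  V ⊓ V.map J = V

variable (L) in
/-- The derived algebra `𝔤' = [𝔤, 𝔤]` as a subspace. -/
def derivedSubspace : Submodule ℝ L :=
  (LieAlgebra.derivedSeries ℝ L 1).toSubmodule

/-- `(L, g, J)` is a two-step solvable SKT Lie algebra (`[𝔤', 𝔤'] = 0`) whose derived algebra is
non-complex and of codimension two. -/
structure IsTwoStepSKTNonComplexCodimTwo (g : LinearMap.BilinForm ℝ L) (J : L →ₗ[ℝ] L) : Prop where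
  skt : IsSKT g J
  two_step : LieAlgebra.derivedSeries ℝ L 2 = ⊥
  non_complex : ¬ IsComplexSubspace J (derivedSubspace L)
  codim_two : Module.finrank ℝ (L ⧸ derivedSubspace L) = 2

/-- Isomorphism of Lie algebras with almost Hermitian structure: a Lie algebra isomorphism that
is isometric and intertwines the almost complex structures. -/
def AreIsomorphic {L' : Type*} [LieRing L'] [LieAlgebra ℝ L']
    (g : LinearMap.BilinForm ℝ L) (J : L →ₗ[ℝ] L)
    (g' : LinearMap.BilinForm ℝ L') (J' : L' →ₗ[ℝ] L') : Prop :=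
  ∃ e : L ≃ₗ⁅ℝ⁆ L', (∀ x y, g' (e x) (e y) = g x y) ∧ ∀ x, e (J x) = J' (e x)

end Geometry

/-- The vector space `𝔞_J ⊕ 𝔞_r ⊕ U_r`, where `𝔞_J = ℂ^m` with its standard basis `Y_1, …, Y_m`,
`𝔞_r = V` and `U_r = V`. The triple `(y, x, u)` stands for `y + x + I₀ u`. -/
abbrev Space (m : ℕ) (V : Type*) : Type _ := (Fin m → ℂ) × V × V

/-- The defining data of `𝔤_{f,h,α}`. The bilinear map `h` is the sum of its symmetric part `h₁`
and its skew part `h₂`. -/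
structure Data (m : ℕ) (V : Type*) [AddCommGroup V] [Module ℝ V] where
  f : V →ₗ[ℝ] V →ₗ[ℝ] V
  h : V →ₗ[ℝ] V →ₗ[ℝ] (Fin m → ℂ)
  α : Fin m → V →ₗ[ℝ] ℂ
  g₀ : LinearMap.BilinForm ℝ V
  τ₀ : LinearMap.BilinForm ℝ V
  f_symm : ∀ x y, f x y = f y x
  f_f_symm : ∀ x y z, f (f x y) z = f (f x z) y
  g₀_symm : ∀ x y, g₀ x y = g₀ y x
  τ₀_skew : ∀ x y, τ₀ x y = -τ₀ y x
  /-- The symmetric form on `𝔞_r ⊕ U_r` determined by `g₀` and `τ₀` is positive definite. -/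
  pos : ∀ x u, (x ≠ 0 ∨ u ≠ 0) → 0 < g₀ x x + g₀ u u + 2 * τ₀ u x

namespace Data

variable {m : ℕ} {V : Type*} [AddCommGroup V] [Module ℝ V] (D : Data m V)

/-- The skew part `h₂` of `h`. -/
noncomputable def h₂ (x y : V) : Fin m → ℂ := (1 / 2 : ℂ) • (D.h x y - D.h y x)

/-- The skew-symmetric bilinear bracket with `[I₀ X, Y_i] = α_i(X) Y_i` (complex linear in the
second entry), `[I₀ X, W] = f(X, W) + h(X, W)`, `[I₀ X, I₀ W] = 2 i h₂(X, W)`, and zero on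
`𝔞_J ⊕ 𝔞_r`. -/
noncomputable def bracket (p q : Space m V) : Space m V :=
  (fun i => D.α i p.2.2 * q.1 i - D.α i q.2.2 * p.1 i
      + D.h p.2.2 q.2.1 i - D.h q.2.2 p.2.1 i
      + 2 * Complex.I * D.h₂ p.2.2 q.2.2 i,
    D.f p.2.2 q.2.1 - D.f q.2.2 p.2.1,
    0)

/-- The bracket satisfies the Jacobi identity. -/
def Jacobi : Prop :=
  ∀ p q r : Space m V,
    D.bracket p (D.bracket q r) = D.bracket (D.bracket p q) r + D.bracket q (D.bracket p r)

/-- The real inner product on `𝔞_J` for which `Y_1, …, Y_m, iY_1, …, iY_m` is orthonormal. -/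
noncomputable def innerJ (y y' : Fin m → ℂ) : ℝ := ∑ i, (conj (y i) * y' i).re

theorem bracket_add_left (p q r : Space m V) :
    D.bracket (p + q) r = D.bracket p r + D.bracket q r := by
  refine Prod.ext (funext fun i => ?_) (Prod.ext ?_ ?_)
  · simp [bracket, h₂]; ring
  · simp [bracket]; abel
  · simp [bracket]

theorem bracket_add_right (p q r : Space m V) :
    D.bracket p (q + r) = D.bracket p q + D.bracket p r := by
  refine Prod.ext (funext fun i => ?_) (Prod.ext ?_ ?_)
  · simp [bracket, h₂]; ring
  · simp [bracket]; abel
  · simp [bracket]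

theorem bracket_self (p : Space m V) : D.bracket p p = 0 := by
  refine Prod.ext (funext fun i => ?_) (Prod.ext ?_ ?_) <;> simp [bracket, h₂]

theorem bracket_smul_right (t : ℝ) (p q : Space m V) :
    D.bracket p (t • q) = t • D.bracket p q := by
  refine Prod.ext (funext fun i => ?_) (Prod.ext ?_ ?_)
  · simp [bracket, h₂]; ring
  · simp [bracket, smul_sub]
  · simp [bracket]

/-- The metric: `𝔞_J` is orthogonal to `𝔞_r ⊕ U_r`, and on the latter
`g(X, W) = g(I₀X, I₀W) = g₀(X, W)`, `g(I₀X, W) = -g(X, I₀W) = τ₀(X, W)`. -/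
noncomputable def spaceMetric : LinearMap.BilinForm ℝ (Space m V) :=
  LinearMap.mk₂ ℝ
    (fun p q => innerJ p.1 q.1 + D.g₀ p.2.1 q.2.1 + D.g₀ p.2.2 q.2.2
      + D.τ₀ p.2.2 q.2.1 + D.τ₀ q.2.2 p.2.1)
    (by intro p q r; simp [innerJ, add_mul, Finset.sum_add_distrib]; ring)
    (by intro t p q; simp [innerJ, Finset.mul_sum, mul_add, mul_assoc])
    (by intro p q r; simp [innerJ, mul_add, Finset.sum_add_distrib]; ring)
    (by intro t p q; simp [innerJ, Finset.mul_sum, mul_add, mul_left_comm])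

/-- The almost complex structure `I (Y + X + I₀ Z) = iY - Z + I₀ X`. -/
noncomputable def spaceI (m : ℕ) (V : Type*) [AddCommGroup V] [Module ℝ V] :
    Space m V →ₗ[ℝ] Space m V where
  toFun p := (Complex.I • p.1, -p.2.2, p.2.1)
  map_add' p q := by
    refine Prod.ext (funext fun i => ?_) (Prod.ext ?_ ?_)
    · simp; ring
    · simp; abel
    · simp
  map_smul' t p := by
    refine Prod.ext (funext fun i => ?_) (Prod.ext ?_ ?_)
    · simp; ring
    · simp
    · simp

/-- The Lie algebra `𝔤_{f,h,α}`, defined once the Jacobi identity is known. -/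
def Model (_hJ : D.Jacobi) : Type _ := Space m V

variable {D} (hJ : D.Jacobi)

instance : AddCommGroup (D.Model hJ) := inferInstanceAs (AddCommGroup (Space m V))

noncomputable instance : Module ℝ (D.Model hJ) := inferInstanceAs (Module ℝ (Space m V))

noncomputable instance : LieRing (D.Model hJ) where
  bracket p q := D.bracket p q
  add_lie := D.bracket_add_left
  lie_add := D.bracket_add_right
  lie_self := D.bracket_self
  leibniz_lie := hJ

noncomputable instance : LieAlgebra ℝ (D.Model hJ) where
  lie_smul := D.bracket_smul_right

/-- The metric of `𝔤_{f,h,α}`. -/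
noncomputable def metric : LinearMap.BilinForm ℝ (D.Model hJ) := D.spaceMetric

/-- The almost complex structure of `𝔤_{f,h,α}`. -/
noncomputable def complexStructure : D.Model hJ →ₗ[ℝ] D.Model hJ := spaceI m V

end Data

section NormalForm

variable {m : ℕ} {V : Type*} [AddCommGroup V] [Module ℝ V]

/-- First case, for a single index `i`, with `h₁₁ = h^i(X_1, X_1)` etc. -/
def CaseI (a b₁ b₂ : ℝ) (z w h₁₁ h₁₂ h₂₁ h₂₂ : ℂ) : Prop :=
  z.re = 0 ∧ w.re = 0 ∧ z ≠ 0 ∧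
    h₂₁ = h₁₂ ∧ h₁₂ = w / z * h₁₁ ∧
    h₂₂ = (w ^ 2 - b₂ * w - b₁ * z) / (z * (z - a)) * h₁₁

/-- Second case. -/
def CaseII (a b₂ : ℝ) (z w h₁₁ h₁₂ h₂₁ h₂₂ : ℂ) : Prop :=
  z = 0 ∧ w.re = 0 ∧ w ≠ 0 ∧
    h₁₁ = 0 ∧ h₂₁ = h₁₂ ∧ h₂₂ = (b₂ - w) / a * h₁₂

/-- Third case. -/
def CaseIII (a b₁ b₂ : ℝ) (z w h₁₁ h₁₂ h₂₁ h₂₂ : ℂ) : Prop :=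
  z.re = -a / 2 ∧ 2 * w.re ^ 2 + b₂ * w.re - b₁ / 2 * a = 0 ∧
    h₁₂ = conj w / conj z * h₁₁ ∧
    h₂₁ = (w * conj z - a * conj w) / ((‖z‖ : ℂ) ^ 2 - a * conj z) * h₁₁ ∧
    h₂₂ = ((‖w‖ : ℂ) ^ 2 - b₁ * conj z - b₂ * conj w) / ((‖z‖ : ℂ) ^ 2 - a * conj z) * h₁₁

/-- The data `D` are in the normal form with parameters `a, b₁, b₂, z, w` with respect to the
basis `(X_1, X_2) = (X 0, X 1)` of `𝔞_r`. -/
structure IsNormalForm (D : Data m V) (X : Module.Basis (Fin 2) ℝ V)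
    (a b₁ b₂ : ℝ) (z w : Fin m → ℂ) : Prop where
  orthonormal : ∀ j k, D.g₀ (X j) (X k) = if j = k then 1 else 0
  a_pos : 0 < a
  b₂_nonneg : 0 ≤ b₂
  f_X₁ : ∀ j, D.f (X 0) (X j) = a • X j
  f_X₂ : D.f (X 1) (X 1) = b₁ • X 0 + b₂ • X 1
  α_X₁ : ∀ i, D.α i (X 0) = z i
  α_X₂ : ∀ i, D.α i (X 1) = w i
  norm_condition :
    2 * a * (a - b₁)
      + Data.innerJ (D.h (X 0) (X 1) - D.h (X 1) (X 0)) (D.h (X 0) (X 1) - D.h (X 1) (X 0))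
      + Data.innerJ (D.h (X 0) (X 1)) (D.h (X 0) (X 1))
      + Data.innerJ (D.h (X 1) (X 0)) (D.h (X 1) (X 0))
      - 2 * Data.innerJ (D.h (X 0) (X 0)) (D.h (X 1) (X 1)) = 0
  cases : ∀ i,
    CaseI a b₁ b₂ (z i) (w i) (D.h (X 0) (X 0) i) (D.h (X 0) (X 1) i)
      (D.h (X 1) (X 0) i) (D.h (X 1) (X 1) i) ∨
    CaseII a b₂ (z i) (w i) (D.h (X 0) (X 0) i) (D.h (X 0) (X 1) i)
      (D.h (X 1) (X 0) i) (D.h (X 1) (X 1) i) ∨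
    CaseIII a b₁ b₂ (z i) (w i) (D.h (X 0) (X 0) i) (D.h (X 0) (X 1) i)
      (D.h (X 1) (X 0) i) (D.h (X 1) (X 1) i)

end NormalForm

end SKT

namespace SKT

section AlternatingForms

variable {M : Type*} [AddCommGroup M] [Module ℝ M]

/-- Linear forms, as plain functions. -/
structure IsAlt₁ (T : M → ℝ) : Prop where
  add : ∀ x x', T (x + x') = T x + T x'
  smul : ∀ (t : ℝ) x, T (t • x) = t * T x

/-- Alternating bilinear forms, as plain functions. -/
structure IsAlt₂ (T : M → M → ℝ) : Prop where
  head : ∀ y, IsAlt₁ fun x => T x y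
  swap : ∀ x y, T x y = -T y x

/-- Alternating trilinear forms, as plain functions. -/
structure IsAlt₃ (T : M → M → M → ℝ) : Prop where
  head : ∀ y z, IsAlt₁ fun x => T x y z
  swap₁ : ∀ x y z, T x y z = -T y x z
  swap₂ : ∀ x y z, T x y z = -T x z y

/-- Alternating quadrilinear forms, as plain functions. -/
structure IsAlt₄ (T : M → M → M → M → ℝ) : Prop where
  head : ∀ y z w, IsAlt₁ fun x => T x y z w
  swap₁ : ∀ x y z w, T x y z w = -T y x z w
  swap₂ : ∀ x y z w, T x y z w = -T x z y w
  swap₃ : ∀ x y z w, T x y z w = -T x y w z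

theorem IsAlt₂.apply {T : M → M → ℝ} (hT : IsAlt₂ T) (e : M) : IsAlt₁ (T e) where
  add x x' := by rw [hT.swap, (hT.head e).add, hT.swap e x, hT.swap e x']; ring
  smul t x := by rw [hT.swap, (hT.head e).smul, hT.swap e x]; ring

theorem IsAlt₃.apply {T : M → M → M → ℝ} (hT : IsAlt₃ T) (e : M) : IsAlt₂ (T e) where
  head y :=
    { add := fun x x' => by
        rw [hT.swap₁, (hT.head e y).add, hT.swap₁ e x, hT.swap₁ e x']; ring
      smul := fun t x => by rw [hT.swap₁, (hT.head e y).smul, hT.swap₁ e x]; ring }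
  swap := hT.swap₂ e

theorem IsAlt₄.apply {T : M → M → M → M → ℝ} (hT : IsAlt₄ T) (e : M) : IsAlt₃ (T e) where
  head y z :=
    { add := fun x x' => by
        rw [hT.swap₁, (hT.head e y z).add, hT.swap₁ e x, hT.swap₁ e x']; ring
      smul := fun t x => by rw [hT.swap₁, (hT.head e y z).smul, hT.swap₁ e x]; ring }
  swap₁ := hT.swap₂ e
  swap₂ := hT.swap₃ e

/-- `x` is the sum of an element with property `P` and a multiple of `e`. -/
def AddLine (P : M → Prop) (e : M) (x : M) : Prop := ∃ s, P s ∧ ∃ t : ℝ, x = s + t • e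

theorem IsAlt₁.vanish {T : M → ℝ} (hT : IsAlt₁ T) {P : M → Prop} {e : M}
    (h₀ : ∀ x, P x → T x = 0) (h₁ : T e = 0) : ∀ x, AddLine P e x → T x = 0 := by
  rintro _ ⟨s, hs, t, rfl⟩
  rw [hT.add, hT.smul, h₀ s hs, h₁]; ring

theorem IsAlt₂.vanish {T : M → M → ℝ} (hT : IsAlt₂ T) {P : M → Prop} {e : M}
    (h₀ : ∀ x y, P x → P y → T x y = 0) (h₁ : ∀ x, P x → T e x = 0) :
    ∀ x y, AddLine P e x → AddLine P e y → T x y = 0 := by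
  have hee : T e e = 0 := by linarith [hT.swap e e]
  rintro _ y ⟨s, hs, t, rfl⟩ hy
  rw [(hT.head y).add, (hT.head y).smul, (hT.apply e).vanish h₁ hee y hy,
    (hT.apply s).vanish (fun x hx => h₀ s x hs hx) (by rw [hT.swap, h₁ s hs, neg_zero]) y hy]
  ring

theorem IsAlt₃.vanish {T : M → M → M → ℝ} (hT : IsAlt₃ T) {P : M → Prop} {e : M}
    (h₀ : ∀ x y z, P x → P y → P z → T x y z = 0) (h₁ : ∀ x y, P x → P y → T e x y = 0) :
    ∀ x y z, AddLine P e x → AddLine P e y → AddLine P e z → T x y z = 0 := by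
  have hee : ∀ x, T e e x = 0 := fun x => by linarith [hT.swap₁ e e x]
  rintro _ y z ⟨s, hs, t, rfl⟩ hy hz
  rw [(hT.head y z).add, (hT.head y z).smul,
    (hT.apply e).vanish h₁ (fun x _ => hee x) y z hy hz,
    (hT.apply s).vanish (fun x x' hx hx' => h₀ s x x' hs hx hx')
      (fun x hx => by rw [hT.swap₁, h₁ s x hs hx, neg_zero]) y z hy hz]
  ring

theorem IsAlt₄.vanish {T : M → M → M → M → ℝ} (hT : IsAlt₄ T) {P : M → Prop} {e : M}
    (h₀ : ∀ x y z w, P x → P y → P z → P w → T x y z w = 0)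
    (h₁ : ∀ x y z, P x → P y → P z → T e x y z = 0) :
    ∀ x y z w, AddLine P e x → AddLine P e y → AddLine P e z → AddLine P e w →
      T x y z w = 0 := by
  have hee : ∀ x y, T e e x y = 0 := fun x y => by linarith [hT.swap₁ e e x y]
  rintro _ y z w ⟨s, hs, t, rfl⟩ hy hz hw
  rw [(hT.head y z w).add, (hT.head y z w).smul,
    (hT.apply e).vanish h₁ (fun x x' _ _ => hee x x') y z w hy hz hw,
    (hT.apply s).vanish (fun x x' x'' hx hx' hx'' => h₀ s x x' x'' hs hx hx' hx'')
      (fun x x' hx hx' => by rw [hT.swap₁, h₁ s x x' hs hx hx', neg_zero]) y z w hy hz hw]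
  ring

end AlternatingForms

section Torsion

variable {L : Type*} [LieRing L] [LieAlgebra ℝ L]
  {g : LinearMap.BilinForm ℝ L} {J : L →ₗ[ℝ] L}

theorem torsionForm_eq (horth : ∀ x y, g (J x) (J y) = g x y) (x y z : L) :
    torsionForm g J x y z = g ⁅J x, J y⁆ z + g ⁅J y, J z⁆ x + g ⁅J z, J x⁆ y := by
  rw [← lie_skew (J z) (J x)]
  simp only [torsionForm, extDeriv₂, fundamentalForm, horth, map_neg, LinearMap.neg_apply]
  ring

theorem isAlt₃_torsionForm (horth : ∀ x y, g (J x) (J y) = g x y) :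
    IsAlt₃ (torsionForm g J) where
  head y z :=
    { add := fun x x' => by
        simp only [torsionForm, extDeriv₂, fundamentalForm, map_add, add_lie,
          LinearMap.add_apply]
        ring
      smul := fun t x => by
        simp only [torsionForm, extDeriv₂, fundamentalForm, map_smul, smul_lie,
          LinearMap.smul_apply, smul_eq_mul]
        ring }
  swap₁ x y z := by
    rw [torsionForm_eq horth, torsionForm_eq horth, ← lie_skew (J x) (J y), ← lie_skew (J y) (J z),
      ← lie_skew (J z) (J x)]
    simp only [map_neg, LinearMap.neg_apply]
    ring
  swap₂ x y z := by
    rw [torsionForm_eq horth, torsionForm_eq horth, ← lie_skew (J x) (J y), ← lie_skew (J y) (J z),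
      ← lie_skew (J z) (J x)]
    simp only [map_neg, LinearMap.neg_apply]
    ring

theorem isAlt₄_extDeriv₃ {γ : L → L → L → ℝ} (hγ : IsAlt₃ γ) : IsAlt₄ (extDeriv₃ γ) := by
  have neg : ∀ x y z, γ (-x) y z = -γ x y z := fun x y z => by
    have := (hγ.head y z).smul (-1) x
    simpa using this
  refine ⟨fun y z w => ⟨fun x x' => ?_, fun t x => ?_⟩, fun x y z w => ?_, fun x y z w => ?_,
    fun x y z w => ?_⟩
  · simp only [extDeriv₃, add_lie, (hγ.head _ _).add, ((hγ.apply _).head _).add]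
    ring
  · simp only [extDeriv₃, smul_lie, (hγ.head _ _).smul, ((hγ.apply _).head _).smul]
    ring
  · simp only [extDeriv₃]
    rw [← lie_skew x y, neg, hγ.swap₂ ⁅z, w⁆ x y]
    ring
  · simp only [extDeriv₃]
    rw [← lie_skew y z, neg, hγ.swap₂ ⁅x, w⁆ y z]
    ring
  · simp only [extDeriv₃]
    rw [← lie_skew z w, neg, hγ.swap₂ ⁅x, y⁆ z w]
    ring

end Torsion

end SKT

namespace SKT

namespace Data

variable {m : ℕ} {V : Type*} [AddCommGroup V] [Module ℝ V] {D : Data m V} (hJ : D.Jacobi)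

/-- The inclusion of `𝔞_J` into `𝔤_{f,h,α}`. -/
def ofJ (y : Fin m → ℂ) : D.Model hJ := ((y, 0, 0) : Space m V)

/-- The inclusion of `𝔞_r` into `𝔤_{f,h,α}`. -/
def ofR (v : V) : D.Model hJ := ((0, v, 0) : Space m V)

/-- The inclusion of `U_r` into `𝔤_{f,h,α}`. -/
def ofU (u : V) : D.Model hJ := ((0, 0, u) : Space m V)

theorem exists_eq_add (x : D.Model hJ) : ∃ y v u, x = ofJ hJ y + ofR hJ v + ofU hJ u := by
  refine ⟨x.1, x.2.1, x.2.2, Prod.ext ?_ (Prod.ext ?_ ?_)⟩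
  · change x.1 = x.1 + 0 + 0; simp
  · change x.2.1 = 0 + x.2.1 + 0; simp
  · change x.2.2 = 0 + 0 + x.2.2; simp

@[simp] theorem ofJ_add (y y' : Fin m → ℂ) : ofJ hJ (y + y') = ofJ hJ y + ofJ hJ y' :=
  Prod.ext rfl (Prod.ext (add_zero _).symm (add_zero _).symm)

@[simp] theorem ofR_add (v v' : V) : ofR hJ (v + v') = ofR hJ v + ofR hJ v' :=
  Prod.ext (add_zero _).symm (Prod.ext rfl (add_zero _).symm)

@[simp] theorem ofU_add (v v' : V) : ofU hJ (v + v') = ofU hJ v + ofU hJ v' :=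
  Prod.ext (add_zero _).symm (Prod.ext (add_zero _).symm rfl)

@[simp] theorem ofR_smul (t : ℝ) (v : V) : ofR hJ (t • v) = t • ofR hJ v :=
  Prod.ext (smul_zero _).symm (Prod.ext rfl (smul_zero _).symm)

@[simp] theorem ofU_smul (t : ℝ) (v : V) : ofU hJ (t • v) = t • ofU hJ v :=
  Prod.ext (smul_zero _).symm (Prod.ext (smul_zero _).symm rfl)

theorem lie_def (x y : D.Model hJ) : ⁅x, y⁆ = (D.bracket x y : Space m V) := rfl

@[simp] theorem lie_ofJ_ofJ (y y' : Fin m → ℂ) : ⁅ofJ hJ y, ofJ hJ y'⁆ = 0 := by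
  rw [lie_def]
  refine Prod.ext (funext fun i => ?_) (Prod.ext ?_ ?_) <;> simp [ofJ, bracket, h₂] <;> rfl

@[simp] theorem lie_ofR_ofR (v v' : V) : ⁅ofR hJ v, ofR hJ v'⁆ = 0 := by
  rw [lie_def]
  refine Prod.ext (funext fun i => ?_) (Prod.ext ?_ ?_) <;> simp [ofR, bracket, h₂] <;> rfl

@[simp] theorem lie_ofR_ofJ (v : V) (y : Fin m → ℂ) : ⁅ofR hJ v, ofJ hJ y⁆ = 0 := by
  rw [lie_def]
  refine Prod.ext (funext fun i => ?_) (Prod.ext ?_ ?_) <;> simp [ofR, ofJ, bracket, h₂] <;> rfl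

@[simp] theorem lie_ofJ_ofR (v : V) (y : Fin m → ℂ) : ⁅ofJ hJ y, ofR hJ v⁆ = 0 := by
  rw [← lie_skew, lie_ofR_ofJ, neg_zero]

@[simp] theorem lie_ofU_ofJ (u : V) (y : Fin m → ℂ) :
    ⁅ofU hJ u, ofJ hJ y⁆ = ofJ hJ fun i => D.α i u * y i := by
  rw [lie_def]
  refine Prod.ext (funext fun i => ?_) (Prod.ext ?_ ?_) <;> simp [ofU, ofJ, bracket, h₂]

@[simp] theorem lie_ofJ_ofU (u : V) (y : Fin m → ℂ) :
    ⁅ofJ hJ y, ofU hJ u⁆ = -ofJ hJ fun i => D.α i u * y i := by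
  rw [← lie_skew, lie_ofU_ofJ]

@[simp] theorem lie_ofU_ofR (u v : V) :
    ⁅ofU hJ u, ofR hJ v⁆ = ofR hJ (D.f u v) + ofJ hJ (D.h u v) := by
  rw [lie_def]
  refine Prod.ext (funext fun i => ?_) (Prod.ext ?_ ?_)
  · change _ = (0 : ℂ) + D.h u v i; simp [ofU, ofR, bracket, h₂]
  · change _ = D.f u v + 0; simp [ofU, ofR, bracket]
  · change _ = (0 : V) + 0; simp [bracket]

@[simp] theorem lie_ofR_ofU (u v : V) :
    ⁅ofR hJ v, ofU hJ u⁆ = -ofR hJ (D.f u v) - ofJ hJ (D.h u v) := by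
  rw [← lie_skew, lie_ofU_ofR]; abel

@[simp] theorem lie_ofU_ofU (u u' : V) :
    ⁅ofU hJ u, ofU hJ u'⁆ = ofJ hJ (Complex.I • (D.h u u' - D.h u' u)) := by
  rw [lie_def]
  refine Prod.ext (funext fun i => ?_) (Prod.ext ?_ ?_) <;> simp [ofU, ofJ, bracket, h₂]
  ring

@[simp] theorem complexStructure_ofJ (y : Fin m → ℂ) :
    complexStructure hJ (ofJ hJ y) = ofJ hJ (Complex.I • y) :=
  Prod.ext rfl (Prod.ext neg_zero rfl)

@[simp] theorem complexStructure_ofR (v : V) :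
    complexStructure hJ (ofR hJ v) = ofU hJ v :=
  Prod.ext (smul_zero _) (Prod.ext neg_zero rfl)

@[simp] theorem complexStructure_ofU (v : V) :
    complexStructure hJ (ofU hJ v) = -ofR hJ v :=
  Prod.ext ((smul_zero _).trans neg_zero.symm) (Prod.ext rfl neg_zero.symm)

theorem metric_apply (x x' : D.Model hJ) :
    metric hJ x x' = innerJ x.1 x'.1 + D.g₀ x.2.1 x'.2.1 + D.g₀ x.2.2 x'.2.2
      + D.τ₀ x.2.2 x'.2.1 + D.τ₀ x'.2.2 x.2.1 := rfl

@[simp] theorem metric_ofJ_ofJ (y y' : Fin m → ℂ) :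
    metric hJ (ofJ hJ y) (ofJ hJ y') = innerJ y y' := by
  rw [metric_apply]; simp [ofJ]

@[simp] theorem metric_ofJ_ofR (y : Fin m → ℂ) (v : V) :
    metric hJ (ofJ hJ y) (ofR hJ v) = 0 := by
  rw [metric_apply]; simp [ofJ, ofR, innerJ]

@[simp] theorem metric_ofR_ofJ (y : Fin m → ℂ) (v : V) :
    metric hJ (ofR hJ v) (ofJ hJ y) = 0 := by
  rw [metric_apply]; simp [ofJ, ofR, innerJ]

@[simp] theorem metric_ofJ_ofU (y : Fin m → ℂ) (v : V) :
    metric hJ (ofJ hJ y) (ofU hJ v) = 0 := by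
  rw [metric_apply]; simp [ofJ, ofU, innerJ]

@[simp] theorem metric_ofU_ofJ (y : Fin m → ℂ) (v : V) :
    metric hJ (ofU hJ v) (ofJ hJ y) = 0 := by
  rw [metric_apply]; simp [ofJ, ofU, innerJ]

@[simp] theorem metric_ofR_ofR (v v' : V) :
    metric hJ (ofR hJ v) (ofR hJ v') = D.g₀ v v' := by
  rw [metric_apply]; simp [ofR, innerJ]

@[simp] theorem metric_ofU_ofU (v v' : V) :
    metric hJ (ofU hJ v) (ofU hJ v') = D.g₀ v v' := by
  rw [metric_apply]; simp [ofU, innerJ]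

@[simp] theorem metric_ofU_ofR (v v' : V) :
    metric hJ (ofU hJ v) (ofR hJ v') = D.τ₀ v v' := by
  rw [metric_apply]; simp [ofU, ofR, innerJ]

@[simp] theorem metric_ofR_ofU (v v' : V) :
    metric hJ (ofR hJ v) (ofU hJ v') = D.τ₀ v' v := by
  rw [metric_apply]; simp [ofU, ofR, innerJ]

theorem innerJ_comm (y y' : Fin m → ℂ) : innerJ y y' = innerJ y' y := by
  refine Finset.sum_congr rfl fun i _ => ?_
  simp only [Complex.mul_re, Complex.conj_re, Complex.conj_im]; ring

theorem innerJ_I_smul (y y' : Fin m → ℂ) :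
    innerJ (Complex.I • y) (Complex.I • y') = innerJ y y' := by
  refine Finset.sum_congr rfl fun i _ => ?_
  simp [Complex.mul_re]

theorem innerJ_self_pos {y : Fin m → ℂ} (hy : y ≠ 0) : 0 < innerJ y y := by
  obtain ⟨i, hi⟩ := Function.ne_iff.mp hy
  have h : ∀ j, (conj (y j) * y j).re = Complex.normSq (y j) := fun j => by
    rw [← Complex.normSq_eq_conj_mul_self]; rfl
  refine Finset.sum_pos' (fun j _ => ?_) ⟨i, Finset.mem_univ i, ?_⟩
  · rw [h]; exact Complex.normSq_nonneg _
  · rw [h]; exact Complex.normSq_pos.mpr hi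

theorem metric_orthogonal (x x' : D.Model hJ) :
    metric hJ (complexStructure hJ x) (complexStructure hJ x') = metric hJ x x' := by
  obtain ⟨y, v, u, rfl⟩ := exists_eq_add hJ x
  obtain ⟨y', v', u', rfl⟩ := exists_eq_add hJ x'
  simp only [map_add, LinearMap.add_apply, complexStructure_ofJ, complexStructure_ofR,
    complexStructure_ofU, map_neg, LinearMap.neg_apply, metric_ofJ_ofJ, metric_ofJ_ofR,
    metric_ofJ_ofU, metric_ofR_ofJ, metric_ofR_ofR, metric_ofR_ofU, metric_ofU_ofJ,
    metric_ofU_ofR, metric_ofU_ofU, innerJ_I_smul]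
  rw [D.τ₀_skew v u', D.τ₀_skew v' u]
  ring

theorem isHermitian : IsHermitian (metric hJ) (complexStructure hJ) where
  symm x x' := by
    rw [metric_apply, metric_apply, innerJ_comm, D.g₀_symm x.2.1, D.g₀_symm x.2.2]; ring
  pos x hx := by
    rw [metric_apply]
    by_cases h : x.2.1 ≠ 0 ∨ x.2.2 ≠ 0
    · have h₁ : 0 ≤ innerJ x.1 x.1 := by
        by_cases hy : x.1 = 0
        · simp [hy, innerJ]
        · exact (innerJ_self_pos hy).le
      linarith [D.pos _ _ h]
    · push Not at h
      have hy : x.1 ≠ 0 := fun hy => hx (Prod.ext hy (Prod.ext h.1 h.2))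
      simpa [h.1, h.2] using innerJ_self_pos hy
  sq x := by
    obtain ⟨y, v, u, rfl⟩ := exists_eq_add hJ x
    have : ofJ hJ (Complex.I • Complex.I • y) = -ofJ hJ y := by
      rw [smul_smul, Complex.I_mul_I]
      exact Prod.ext (by simp [ofJ]; rfl) (Prod.ext neg_zero.symm neg_zero.symm)
    simp only [map_add, complexStructure_ofJ, complexStructure_ofR, complexStructure_ofU, map_neg,
      this]
    abel
  orthogonal := metric_orthogonal hJ
  integrable x x' := by
    obtain ⟨y, v, u⟩ := x
    obtain ⟨y', v', u'⟩ := x'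
    change D.bracket (spaceI m V (y, v, u)) (spaceI m V (y', v', u'))
      - spaceI m V (D.bracket (spaceI m V (y, v, u)) (y', v', u'))
      - spaceI m V (D.bracket (y, v, u) (spaceI m V (y', v', u')))
      - D.bracket (y, v, u) (y', v', u') = (0 : Space m V)
    refine Prod.ext (funext fun i => ?_) (Prod.ext ?_ ?_)
    · simp [bracket, spaceI, h₂]
      linear_combination
        (-D.α i u * y' i + D.α i u' * y i - D.h u v' i + D.h u' v i
          - D.h v u' i + D.h v' u i) * Complex.I_mul_I
    · simp [bracket, spaceI, D.f_symm v u', D.f_symm v' u]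
      abel
    · simp [bracket, spaceI, D.f_symm v v', D.f_symm u u']

theorem torsion_eq (x y z : D.Model hJ) :
    torsionForm (metric hJ) (complexStructure hJ) x y z =
      metric hJ ⁅complexStructure hJ x, complexStructure hJ y⁆ z
      + metric hJ ⁅complexStructure hJ y, complexStructure hJ z⁆ x
      + metric hJ ⁅complexStructure hJ z, complexStructure hJ x⁆ y :=
  torsionForm_eq (metric_orthogonal hJ) x y z

theorem extDeriv_JJJJ (y y' y₃ y₄ : Fin m → ℂ) :
    extDeriv₃ (torsionForm (metric hJ) (complexStructure hJ))
      (ofJ hJ y) (ofJ hJ y') (ofJ hJ y₃) (ofJ hJ y₄) = 0 := by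
  simp [extDeriv₃, torsion_eq]

theorem extDeriv_RJJJ (v : V) (y y' y₃ : Fin m → ℂ) :
    extDeriv₃ (torsionForm (metric hJ) (complexStructure hJ))
      (ofR hJ v) (ofJ hJ y) (ofJ hJ y') (ofJ hJ y₃) = 0 := by
  simp [extDeriv₃, torsion_eq]

theorem extDeriv_RRJJ (v v' : V) (y y' : Fin m → ℂ) :
    extDeriv₃ (torsionForm (metric hJ) (complexStructure hJ))
      (ofR hJ v) (ofR hJ v') (ofJ hJ y) (ofJ hJ y') = 0 := by
  simp [extDeriv₃, torsion_eq]

theorem extDeriv_UJJJ (v : V) (y y' y₃ : Fin m → ℂ) :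
    extDeriv₃ (torsionForm (metric hJ) (complexStructure hJ))
      (ofU hJ v) (ofJ hJ y) (ofJ hJ y') (ofJ hJ y₃) = 0 := by
  simp [extDeriv₃, torsion_eq]

theorem extDeriv_UUJJ (v v' : V) (y y' : Fin m → ℂ) :
    extDeriv₃ (torsionForm (metric hJ) (complexStructure hJ))
      (ofU hJ v) (ofU hJ v') (ofJ hJ y) (ofJ hJ y') = 0 := by
  simp [extDeriv₃, torsion_eq]

theorem extDeriv_URJJ (u v : V) (y y' : Fin m → ℂ) :
    extDeriv₃ (torsionForm (metric hJ) (complexStructure hJ))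
      (ofU hJ u) (ofR hJ v) (ofJ hJ y) (ofJ hJ y') =
    -∑ i, (4 * (D.α i u).re * (D.α i v).re + 2 * (D.α i (D.f u v)).re)
      * (conj (Complex.I * y i) * y' i).re := by
  simp [extDeriv₃, torsion_eq]
  simp only [innerJ,
    ← Finset.sum_neg_distrib, ← Finset.sum_add_distrib, ← Finset.sum_sub_distrib]
  refine Finset.sum_congr rfl fun i _ => ?_
  simp [Complex.mul_re, Complex.mul_im]
  ring

theorem extDeriv_URRJ (u v v' : V) (y : Fin m → ℂ) :
    extDeriv₃ (torsionForm (metric hJ) (complexStructure hJ))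
      (ofU hJ u) (ofR hJ v) (ofR hJ v') (ofJ hJ y) =
    -∑ i, (conj (Complex.I * (conj (D.α i u) * (D.h v v' i - D.h v' v i)
        + (D.h (D.f u v) v' i - D.h v' (D.f u v) i) + (D.h v (D.f u v') i - D.h (D.f u v') v i)
        - 2 * (D.α i v').re * D.h u v i + 2 * (D.α i v).re * D.h u v' i)) * y i).re := by
  simp [extDeriv₃, torsion_eq]
  simp only [innerJ,
    ← Finset.sum_neg_distrib, ← Finset.sum_add_distrib, ← Finset.sum_sub_distrib]
  refine Finset.sum_congr rfl fun i _ => ?_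
  simp [Complex.mul_re, Complex.mul_im]
  ring

theorem extDeriv_UURJ (u u' v : V) (y : Fin m → ℂ) :
    extDeriv₃ (torsionForm (metric hJ) (complexStructure hJ))
      (ofU hJ u) (ofU hJ u') (ofR hJ v) (ofJ hJ y) =
    -∑ i, (conj (2 * (D.α i v).re * (D.h u u' i - D.h u' u i) + conj (D.α i u) * D.h v u' i
        - conj (D.α i u') * D.h v u i + D.h (D.f u v) u' i - D.h (D.f u' v) u i) * y i).re := by
  simp [extDeriv₃, torsion_eq]
  simp only [innerJ,
    ← Finset.sum_neg_distrib, ← Finset.sum_add_distrib, ← Finset.sum_sub_distrib]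
  refine Finset.sum_congr rfl fun i _ => ?_
  simp [Complex.mul_re, Complex.mul_im]
  ring

theorem extDeriv_UURR (u u' v v' : V) :
    extDeriv₃ (torsionForm (metric hJ) (complexStructure hJ))
      (ofU hJ u) (ofU hJ u') (ofR hJ v) (ofR hJ v') =
    -innerJ (D.h v v' - D.h v' v) (D.h u u' - D.h u' u) + innerJ (D.h v' u') (D.h u v)
      - innerJ (D.h v u') (D.h u v') - innerJ (D.h v' u) (D.h u' v) + innerJ (D.h v u) (D.h u' v')
      + 2 * D.g₀ (D.f v' u') (D.f u v) - 2 * D.g₀ (D.f v u') (D.f u v') := by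
  have h₁ : D.f (D.f u v) u' = D.f (D.f u' v) u := by
    rw [D.f_symm u v, D.f_f_symm, D.f_symm u' v]
  have h₂ : D.f (D.f u v') u' = D.f (D.f u' v') u := by
    rw [D.f_symm u v', D.f_f_symm, D.f_symm u' v']
  simp [extDeriv₃, torsion_eq, innerJ_I_smul, h₁, h₂]
  rw [D.g₀_symm (D.f v' u) (D.f u' v), D.g₀_symm (D.f v u) (D.f u' v'), D.f_symm v u, D.f_symm v u',
    D.f_symm v' u, D.f_symm v' u']
  ring

end Data

end SKT

namespace SKT

section DerivedAlgebra

variable {L : Type*} [LieRing L] [LieAlgebra ℝ L]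

theorem lie_mem_derivedSubspace (x y : L) : ⁅x, y⁆ ∈ derivedSubspace L := by
  change ⁅x, y⁆ ∈ LieAlgebra.derivedSeries ℝ L 1
  rw [LieAlgebra.derivedSeries_def, LieAlgebra.derivedSeriesOfIdeal_succ,
    LieAlgebra.derivedSeriesOfIdeal_zero]
  exact LieSubmodule.lie_mem_lie (LieSubmodule.mem_top x) (LieSubmodule.mem_top y)

theorem derivedSubspace_le {S : Submodule ℝ L} (h : ∀ x y : L, ⁅x, y⁆ ∈ S) :
    derivedSubspace L ≤ S := by
  rw [derivedSubspace, LieAlgebra.derivedSeries_def, LieAlgebra.derivedSeriesOfIdeal_succ,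
    LieAlgebra.derivedSeriesOfIdeal_zero, LieSubmodule.lieIdeal_oper_eq_linear_span',
    Submodule.span_le]
  rintro _ ⟨x, -, y, -, rfl⟩
  exact h x y

theorem derivedSeries_two_eq_bot_iff :
    LieAlgebra.derivedSeries ℝ L 2 = ⊥ ↔
      ∀ x ∈ derivedSubspace L, ∀ y ∈ derivedSubspace L, ⁅x, y⁆ = 0 := by
  rw [LieAlgebra.derivedSeries_def, LieAlgebra.derivedSeriesOfIdeal_succ,
    LieSubmodule.lie_eq_bot_iff]
  rfl

end DerivedAlgebra

section ScalarEquations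

/-- The equations on the `i`-th components equivalent to the Jacobi identity and the closure of the
torsion. -/
structure ComponentEquations (a b₁ b₂ : ℝ) (z w p q r s : ℂ) : Prop where
  jacobi₁ : z * r + a * q = w * p + a * r
  jacobi₂ : z * s + b₁ * p + b₂ * q = w * q + a * s
  re₁ : 4 * z.re * z.re + 2 * (a * z.re) = 0
  re₂ : 4 * z.re * w.re + 2 * (a * w.re) = 0
  re₃ : 4 * w.re * w.re + 2 * (b₁ * z.re + b₂ * w.re) = 0
  skew₁ : (conj z + 2 * a) * (q - r) - 2 * w.re * p + 2 * z.re * q = 0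
  skew₂ : (conj w + b₂) * (q - r) - 2 * w.re * r + 2 * z.re * s = 0
  mixed₁ : 2 * z.re * (q - r) + conj z * q - conj w * p + a * q - a * r = 0
  mixed₂ : 2 * w.re * (q - r) + conj z * s - conj w * r + a * s - (b₁ * p + b₂ * r) = 0

variable {a b₁ b₂ : ℝ} {z w p q r s : ℂ}

theorem conj_eq_neg_of_re_eq_zero {z : ℂ} (h : z.re = 0) : conj z = -z :=
  Complex.ext (by simp [h]) (by simp)

theorem ofReal_norm_sq (z : ℂ) : ((‖z‖ : ℝ) : ℂ) ^ 2 = z * conj z := by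
  rw [Complex.mul_conj, Complex.normSq_eq_norm_sq]; push_cast; rfl

theorem sub_ofReal_ne_zero {z : ℂ} (h : z.re ≠ a) : z - a ≠ 0 := fun h' =>
  h (by simpa [sub_eq_zero] using congrArg Complex.re h')

theorem CaseI.componentEquations (ha : 0 < a) (h : CaseI a b₁ b₂ z w p q r s) :
    ComponentEquations a b₁ b₂ z w p q r s := by
  obtain ⟨hz, hw, hz0, rfl, rfl, rfl⟩ := h
  have hza : z - a ≠ 0 := sub_ofReal_ne_zero (by rw [hz]; exact ha.ne)
  refine ⟨?_, ?_, ?_, ?_, ?_, ?_, ?_, ?_, ?_⟩ <;>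
    try simp only [hz, hw, conj_eq_neg_of_re_eq_zero hz, conj_eq_neg_of_re_eq_zero hw,
      Complex.ofReal_zero]
  all_goals field_simp
  all_goals ring

theorem CaseII.componentEquations (ha : 0 < a) (h : CaseII a b₂ z w p q r s) :
    ComponentEquations a b₁ b₂ z w p q r s := by
  obtain ⟨rfl, hw, hw0, rfl, rfl, rfl⟩ := h
  have ha' : (a : ℂ) ≠ 0 := by exact_mod_cast ha.ne'
  refine ⟨?_, ?_, ?_, ?_, ?_, ?_, ?_, ?_, ?_⟩ <;>
    try simp only [hw, conj_eq_neg_of_re_eq_zero hw, Complex.zero_re, map_zero,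
      Complex.ofReal_zero]
  all_goals field_simp
  all_goals ring

theorem CaseIII.ne_zero (ha : 0 < a) (h : CaseIII a b₁ b₂ z w p q r s) : z ≠ 0 := by
  rintro rfl
  have := h.1
  rw [Complex.zero_re] at this
  linarith

theorem CaseIII.componentEquations (ha : 0 < a) (h : CaseIII a b₁ b₂ z w p q r s) :
    ComponentEquations a b₁ b₂ z w p q r s := by
  have hz0 := h.ne_zero ha
  obtain ⟨hz, hw, hq, hr, hs⟩ := h
  rw [ofReal_norm_sq] at hr hs
  rw [ofReal_norm_sq] at hs
  have hza : z - a ≠ 0 := sub_ofReal_ne_zero (by rw [hz]; intro h; linarith)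
  have hcz : conj z ≠ 0 := by simpa using hz0
  have e₁ : z + conj z = -a := by
    rw [Complex.add_conj, hz]; push_cast; ring
  have e₂ : w + conj w = 2 * w.re := by rw [Complex.add_conj]; push_cast; ring
  have e₃ : (w + conj w) ^ 2 + b₂ * (w + conj w) - b₁ * a = 0 := by
    have h : (2 * (2 * w.re ^ 2 + b₂ * w.re - b₁ / 2 * a) : ℂ) = 0 := by
      exact_mod_cast congrArg (2 * ·) hw |>.trans (mul_zero 2)
    rw [e₂]; linear_combination h
  have hden : z * conj z - a * conj z = conj z * (z - a) := by ring
  rw [hden] at hr hs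
  have hq' : conj z * q = conj w * p := by rw [hq]; field_simp
  have hr' : (z - a) * r = w * p - a * q := by
    rw [hr, hq]; field_simp
  have hs' : (z - a) * s = w * q - b₁ * p - b₂ * q := by
    rw [hs, hq]; field_simp
  have hrz : ((2 * z.re : ℝ) : ℂ) = -a := by rw [hz]; push_cast; ring
  push_cast at hrz
  refine ⟨?_, ?_, ?_, ?_, ?_, ?_, ?_, ?_, ?_⟩
  · linear_combination hr'
  · linear_combination hs'
  · rw [hz]; ring
  · rw [hz]; ring
  · rw [hz]; linear_combination 2 * hw
  · rw [← e₂, hrz]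
    linear_combination hq' + hr' - r * e₁
  · rw [← e₂, hrz]
    apply mul_left_cancel₀ hza
    linear_combination -(conj w + b₂ + w + conj w) * hr' - a * hs' + (conj w + b₂) * q * e₁
      - (conj w + b₂) * hq' - p * e₃
  · rw [hrz]
    linear_combination hq'
  · rw [← e₂]
    apply mul_left_cancel₀ hza
    linear_combination -(w + 2 * conj w + b₂) * hr' + (conj z + a) * hs'
      + (w * q - b₁ * p - b₂ * q) * e₁ + (conj w + b₂) * q * e₁ - (conj w + b₂) * hq' - p * e₃

theorem ComponentEquations.cases (ha : 0 < a) (h : ComponentEquations a b₁ b₂ z w p q r s)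
    (hne : z ≠ 0 ∨ w ≠ 0) :
    CaseI a b₁ b₂ z w p q r s ∨ CaseII a b₂ z w p q r s ∨ CaseIII a b₁ b₂ z w p q r s := by
  have ha' : (a : ℂ) ≠ 0 := by exact_mod_cast ha.ne'
  have hre : z.re = 0 ∨ z.re = -a / 2 := by
    have : z.re * (z.re + a / 2) = 0 := by linear_combination h.re₁ / 4
    rcases mul_eq_zero.mp this with h | h
    · exact .inl h
    · exact .inr (by linarith)
  rcases hre with hz | hz
  · have hw : w.re = 0 := by
      have := h.re₂
      rw [hz] at this
      have : a * w.re = 0 := by linarith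
      exact (mul_eq_zero.mp this).resolve_left ha.ne'
    have hqr : q - r = 0 := by
      have h₁ := h.skew₁
      rw [hz, hw, conj_eq_neg_of_re_eq_zero hz, Complex.ofReal_zero] at h₁
      have hn : -z + 2 * a ≠ 0 := fun h' => by
        have := congrArg Complex.re h'
        simp [hz] at this
        exact ha.ne' this
      exact (mul_eq_zero.mp (by linear_combination h₁ : (-z + 2 * a) * (q - r) = 0)).resolve_left hn
    obtain rfl : q = r := sub_eq_zero.mp hqr
    have e₁ : z * q = w * p := by linear_combination h.jacobi₁
    have e₂ : (z - a) * s = w * q - b₁ * p - b₂ * q := by linear_combination h.jacobi₂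
    have hza : z - a ≠ 0 := sub_ofReal_ne_zero (by rw [hz]; exact ha.ne)
    by_cases hz0 : z = 0
    · subst hz0
      have hw0 : w ≠ 0 := hne.resolve_left (fun h => h rfl)
      have hp : p = 0 := (mul_eq_zero.mp (by linear_combination -e₁ : w * p = 0)).resolve_left hw0
      refine .inr (.inl ⟨rfl, hw, hw0, hp, rfl, ?_⟩)
      rw [hp] at e₂
      field_simp
      linear_combination -e₂
    · refine .inl ⟨hz, hw, hz0, rfl, ?_, ?_⟩
      · field_simp
        linear_combination e₁
      · field_simp
        linear_combination z * e₂ + (w - b₂) * e₁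
  · refine .inr (.inr ⟨hz, ?_, ?_⟩)
    · have := h.re₃
      rw [hz] at this
      linear_combination this / 2
    · have hz0 : z ≠ 0 := by
        rintro rfl
        rw [Complex.zero_re] at hz
        linarith
      have hza : z - a ≠ 0 := sub_ofReal_ne_zero (by rw [hz]; intro h; linarith)
      have hcz : conj z ≠ 0 := by simpa using hz0
      have hrz : ((2 * z.re : ℝ) : ℂ) = -a := by rw [hz]; push_cast; ring
      push_cast at hrz
      have e₀ : conj z * q = conj w * p := by
        have := h.mixed₁
        rw [hrz] at this
        linear_combination this
      have e₁ : (z - a) * r = w * p - a * q := by linear_combination h.jacobi₁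
      have e₂ : (z - a) * s = w * q - b₁ * p - b₂ * q := by linear_combination h.jacobi₂
      have hden : z * conj z - a * conj z = conj z * (z - a) := by ring
      rw [ofReal_norm_sq, ofReal_norm_sq, hden]
      refine ⟨?_, ?_, ?_⟩
      · field_simp
        linear_combination e₀
      · field_simp
        linear_combination conj z * e₁ - a * e₀
      · field_simp
        linear_combination conj z * e₂ + (w - b₂) * e₀

end ScalarEquations

namespace Data

variable {m : ℕ} {V : Type*} [AddCommGroup V] [Module ℝ V] {D : Data m V}

theorem jacobi_of_identities
    (h₁ : ∀ i u u' v, D.α i u * D.h u' v i + D.h u (D.f u' v) i =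
      D.α i u' * D.h u v i + D.h u' (D.f u v) i)
    (h₂ : ∀ i u u' v, D.α i u * (D.h u' v i - D.h v u' i) + D.α i u' * (D.h v u i - D.h u v i)
      + D.α i v * (D.h u u' i - D.h u' u i) = 0) : D.Jacobi := by
  rintro ⟨y, v, u⟩ ⟨y', v', u'⟩ ⟨y₃, v₃, u₃⟩
  have hf : ∀ x y z, D.f x (D.f y z) = D.f y (D.f x z) := fun x y z => by
    rw [D.f_symm x, D.f_symm y z, D.f_f_symm, D.f_symm _ y, D.f_symm z x]
  refine Prod.ext (funext fun i => ?_) (Prod.ext ?_ ?_)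
  · simp [bracket, Data.h₂]
    linear_combination h₁ i u u' v₃ + h₁ i u' u₃ v + h₁ i u₃ u v' + Complex.I * h₂ i u u' u₃
  · simp [bracket]
    rw [hf u u' v₃, hf u u₃ v', hf u' u₃ v]
    abel
  · simp [bracket]

end Data

section Converse

variable {m : ℕ} {V : Type*} [AddCommGroup V] [Module ℝ V] {D : Data m V}
  {X : Module.Basis (Fin 2) ℝ V} {a b₁ b₂ : ℝ} {z w : Fin m → ℂ}

theorem exists_coords (X : Module.Basis (Fin 2) ℝ V) (v : V) :
    ∃ s t : ℝ, v = s • X 0 + t • X 1 :=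
  ⟨X.repr v 0, X.repr v 1, by rw [← Fin.sum_univ_two fun j => X.repr v j • X j, X.sum_repr]⟩

namespace IsNormalForm

theorem componentEquations (hN : IsNormalForm D X a b₁ b₂ z w) (i : Fin m) :
    ComponentEquations a b₁ b₂ (z i) (w i) (D.h (X 0) (X 0) i) (D.h (X 0) (X 1) i)
      (D.h (X 1) (X 0) i) (D.h (X 1) (X 1) i) := by
  rcases hN.cases i with h | h | h
  · exact h.componentEquations hN.a_pos
  · exact h.componentEquations hN.a_pos
  · exact h.componentEquations hN.a_pos

theorem ne_zero (hN : IsNormalForm D X a b₁ b₂ z w) (i : Fin m) : z i ≠ 0 ∨ w i ≠ 0 := by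
  rcases hN.cases i with h | h | h
  · exact .inl h.2.2.1
  · exact .inr h.2.2.1
  · exact .inl (h.ne_zero hN.a_pos)

theorem f_X₂_X₁ (hN : IsNormalForm D X a b₁ b₂ z w) : D.f (X 1) (X 0) = a • X 1 := by
  rw [D.f_symm, hN.f_X₁]

theorem jacobi (hN : IsNormalForm D X a b₁ b₂ z w) : D.Jacobi := by
  refine Data.jacobi_of_identities (fun i u u' v => ?_) fun i u u' v => ?_
  · obtain ⟨s, t, rfl⟩ := exists_coords X u
    obtain ⟨s', t', rfl⟩ := exists_coords X u'
    obtain ⟨x, y, rfl⟩ := exists_coords X v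
    have h := hN.componentEquations i
    simp only [map_add, map_smul, LinearMap.add_apply, LinearMap.smul_apply, hN.f_X₁, hN.f_X₂,
      hN.f_X₂_X₁, hN.α_X₁, hN.α_X₂, Pi.add_apply, Pi.smul_apply, Complex.real_smul]
    linear_combination (s * t' - t * s') * (x * h.jacobi₁ + y * h.jacobi₂)
  · obtain ⟨s, t, rfl⟩ := exists_coords X u
    obtain ⟨s', t', rfl⟩ := exists_coords X u'
    obtain ⟨x, y, rfl⟩ := exists_coords X v
    simp only [map_add, map_smul, LinearMap.add_apply, LinearMap.smul_apply,
      Pi.add_apply, Pi.smul_apply, Complex.real_smul]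
    ring

theorem le_b₁ (hN : IsNormalForm D X a b₁ b₂ z w) {i : Fin m} (hi : (z i).re = -a / 2) :
    b₁ ≥ -b₂ ^ 2 / (4 * a) := by
  have ha := hN.a_pos
  have h := (hN.componentEquations i).re₃
  rw [hi] at h
  rw [ge_iff_le, div_le_iff₀ (by linarith)]
  nlinarith [sq_nonneg (4 * (w i).re + b₂)]

theorem torsion_closed (hN : IsNormalForm D X a b₁ b₂ z w) (hJ : D.Jacobi)
    (x₁ x₂ x₃ x₄ : D.Model hJ) :
    extDeriv₃ (torsionForm (Data.metric hJ) (Data.complexStructure hJ)) x₁ x₂ x₃ x₄ = 0 := by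
  have hT := isAlt₄_extDeriv₃ (isAlt₃_torsionForm (Data.metric_orthogonal hJ))
  let P : D.Model hJ → Prop := fun x => ∃ y, x = Data.ofJ hJ y
  have hall : ∀ x, AddLine (AddLine (AddLine (AddLine P (Data.ofR hJ (X 0))) (Data.ofR hJ (X 1)))
      (Data.ofU hJ (X 0))) (Data.ofU hJ (X 1)) x := fun x => by
    obtain ⟨y, v, u, rfl⟩ := Data.exists_eq_add hJ x
    obtain ⟨s, t, rfl⟩ := exists_coords X u
    obtain ⟨x, x', rfl⟩ := exists_coords X v
    refine ⟨_, ⟨_, ⟨_, ⟨_, ⟨y, rfl⟩, x, rfl⟩, x', rfl⟩, s, rfl⟩, t, ?_⟩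
    simp only [Data.ofR_add, Data.ofR_smul, Data.ofU_add, Data.ofU_smul]
    abel
  have hz₀ : ∀ y : ℂ, (conj (0 : ℂ) * y).re = 0 := by simp
  refine hT.vanish
    (hT.vanish
      (hT.vanish
        (hT.vanish ?_ ?_)
        ((hT.apply _).vanish ?_ ?_))
      ((hT.apply _).vanish
        ((hT.apply _).vanish ?_ ?_)
        (((hT.apply _).apply _).vanish ?_ ?_)))
    ((hT.apply _).vanish
      ((hT.apply _).vanish
        ((hT.apply _).vanish ?_ ?_)
        (((hT.apply _).apply _).vanish ?_ ?_))
      (((hT.apply _).apply _).vanish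
        (((hT.apply _).apply _).vanish ?_ ?_)
        ((((hT.apply _).apply _).apply _).vanish ?_ ?_)))
    x₁ x₂ x₃ x₄ (hall x₁) (hall x₂) (hall x₃) (hall x₄)
  · rintro _ _ _ _ ⟨y₁, rfl⟩ ⟨y₂, rfl⟩ ⟨y₃, rfl⟩ ⟨y₄, rfl⟩
    exact Data.extDeriv_JJJJ hJ _ _ _ _
  · rintro _ _ _ ⟨y₁, rfl⟩ ⟨y₂, rfl⟩ ⟨y₃, rfl⟩
    exact Data.extDeriv_RJJJ hJ _ _ _ _
  · rintro _ _ _ ⟨y₁, rfl⟩ ⟨y₂, rfl⟩ ⟨y₃, rfl⟩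
    exact Data.extDeriv_RJJJ hJ _ _ _ _
  · rintro _ _ ⟨y₁, rfl⟩ ⟨y₂, rfl⟩
    exact Data.extDeriv_RRJJ hJ _ _ _ _
  · rintro _ _ _ ⟨y₁, rfl⟩ ⟨y₂, rfl⟩ ⟨y₃, rfl⟩
    exact Data.extDeriv_UJJJ hJ _ _ _ _
  · rintro _ _ ⟨y₁, rfl⟩ ⟨y₂, rfl⟩
    rw [Data.extDeriv_URJJ, neg_eq_zero]
    refine Finset.sum_eq_zero fun i _ => ?_
    rw [hN.f_X₁, map_smul, hN.α_X₁, Complex.smul_re, smul_eq_mul,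
      (hN.componentEquations i).re₁, zero_mul]
  · rintro _ _ ⟨y₁, rfl⟩ ⟨y₂, rfl⟩
    rw [Data.extDeriv_URJJ, neg_eq_zero]
    refine Finset.sum_eq_zero fun i _ => ?_
    rw [hN.f_X₁, map_smul, hN.α_X₁, hN.α_X₂, Complex.smul_re, smul_eq_mul,
      (hN.componentEquations i).re₂, zero_mul]
  · rintro _ ⟨y₁, rfl⟩
    rw [Data.extDeriv_URRJ, neg_eq_zero]
    refine Finset.sum_eq_zero fun i _ => ?_
    rw [← hz₀ (y₁ i)]
    congr 3
    simp only [hN.f_X₁, hN.α_X₁, hN.α_X₂, map_smul, LinearMap.smul_apply, Pi.smul_apply,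
      Complex.real_smul]
    linear_combination -Complex.I * (hN.componentEquations i).skew₁
  · rintro _ _ _ ⟨y₁, rfl⟩ ⟨y₂, rfl⟩ ⟨y₃, rfl⟩
    exact Data.extDeriv_UJJJ hJ _ _ _ _
  · rintro _ _ ⟨y₁, rfl⟩ ⟨y₂, rfl⟩
    rw [Data.extDeriv_URJJ, neg_eq_zero]
    refine Finset.sum_eq_zero fun i _ => ?_
    rw [hN.f_X₂_X₁, map_smul, hN.α_X₁, hN.α_X₂, Complex.smul_re, smul_eq_mul,
      mul_right_comm, (hN.componentEquations i).re₂, zero_mul]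
  · rintro _ _ ⟨y₁, rfl⟩ ⟨y₂, rfl⟩
    rw [Data.extDeriv_URJJ, neg_eq_zero]
    refine Finset.sum_eq_zero fun i _ => ?_
    rw [hN.f_X₂, map_add, map_smul, map_smul, hN.α_X₁, hN.α_X₂, Complex.add_re, Complex.smul_re,
      Complex.smul_re, smul_eq_mul, smul_eq_mul, (hN.componentEquations i).re₃, zero_mul]
  · rintro _ ⟨y₁, rfl⟩
    rw [Data.extDeriv_URRJ, neg_eq_zero]
    refine Finset.sum_eq_zero fun i _ => ?_
    rw [← hz₀ (y₁ i)]
    congr 3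
    simp only [hN.f_X₂, hN.f_X₂_X₁, hN.α_X₁, hN.α_X₂, map_smul, map_add, LinearMap.add_apply,
      Pi.add_apply, LinearMap.smul_apply, Pi.smul_apply, Complex.real_smul]
    linear_combination -Complex.I * (hN.componentEquations i).skew₂
  · rintro _ _ ⟨y₁, rfl⟩ ⟨y₂, rfl⟩
    exact Data.extDeriv_UUJJ hJ _ _ _ _
  · rintro _ ⟨y₁, rfl⟩
    rw [Data.extDeriv_UURJ, neg_eq_zero]
    refine Finset.sum_eq_zero fun i _ => ?_
    rw [← hz₀ (y₁ i)]
    congr 3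
    simp only [hN.f_X₁, hN.f_X₂_X₁, hN.α_X₁, hN.α_X₂, map_smul, LinearMap.smul_apply,
      Pi.smul_apply, Complex.real_smul]
    linear_combination -(hN.componentEquations i).mixed₁
  · rintro _ ⟨y₁, rfl⟩
    rw [Data.extDeriv_UURJ, neg_eq_zero]
    refine Finset.sum_eq_zero fun i _ => ?_
    rw [← hz₀ (y₁ i)]
    congr 3
    simp only [hN.f_X₁, hN.f_X₂, hN.α_X₁, hN.α_X₂, map_smul, map_add, LinearMap.add_apply,
      Pi.add_apply, LinearMap.smul_apply, Pi.smul_apply, Complex.real_smul]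
    linear_combination -(hN.componentEquations i).mixed₂
  · rw [Data.extDeriv_UURR]
    have h := hN.norm_condition
    simp only [hN.f_X₁, hN.f_X₂, hN.f_X₂_X₁, map_smul, map_add,
      LinearMap.smul_apply, hN.orthonormal, smul_eq_mul]
    have e : Data.innerJ (D.h (X 1) (X 0) - D.h (X 0) (X 1)) (D.h (X 1) (X 0) - D.h (X 0) (X 1)) =
        Data.innerJ (D.h (X 0) (X 1) - D.h (X 1) (X 0)) (D.h (X 0) (X 1) - D.h (X 1) (X 0)) :=
      Finset.sum_congr rfl fun i _ => by
        rw [← neg_sub (D.h (X 0) (X 1)), Pi.neg_apply, map_neg, neg_mul_neg]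
    rw [e, Data.innerJ_comm (D.h (X 1) (X 1)) (D.h (X 0) (X 0))]
    norm_num
    linear_combination -h

end IsNormalForm

end Converse

end SKT

namespace SKT

section Converse

variable {m : ℕ} {V : Type*} [AddCommGroup V] [Module ℝ V] {D : Data m V}
  {X : Module.Basis (Fin 2) ℝ V} {a b₁ b₂ : ℝ} {z w : Fin m → ℂ}

/-- The projection of `𝔤_{f,h,α}` to `U_r`. -/
noncomputable def Data.projU (hJ : D.Jacobi) : D.Model hJ →ₗ[ℝ] V :=
  (LinearMap.snd ℝ V V ∘ₗ LinearMap.snd ℝ (Fin m → ℂ) (V × V) : Space m V →ₗ[ℝ] V)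

theorem Data.projU_surjective (hJ : D.Jacobi) : Function.Surjective (D.projU hJ) :=
  fun u => ⟨Data.ofU hJ u, rfl⟩

theorem Data.exists_eq_add_of_mem_ker {hJ : D.Jacobi} {x : D.Model hJ}
    (hx : x ∈ LinearMap.ker (D.projU hJ)) : ∃ y v, x = Data.ofJ hJ y + Data.ofR hJ v := by
  refine ⟨x.1, x.2.1, Prod.ext ?_ (Prod.ext ?_ ?_)⟩
  · exact (add_zero _).symm
  · exact (zero_add _).symm
  · exact hx.trans (add_zero _).symm

namespace IsNormalForm

theorem derivedSubspace_eq (hN : IsNormalForm D X a b₁ b₂ z w) (hJ : D.Jacobi) :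
    derivedSubspace (D.Model hJ) = LinearMap.ker (D.projU hJ) := by
  refine le_antisymm (derivedSubspace_le fun _ _ => rfl) fun x hx => ?_
  have hJmem : ∀ y, Data.ofJ hJ y ∈ derivedSubspace (D.Model hJ) := by
    intro y
    have hsum : Data.ofJ hJ y = ∑ i, Data.ofJ hJ (Pi.single i (y i)) := by
      let φ : (Fin m → ℂ) →+ D.Model hJ := ⟨⟨Data.ofJ hJ, rfl⟩, Data.ofJ_add hJ⟩
      change φ y = ∑ i, φ (Pi.single i (y i))
      rw [← map_sum, Finset.univ_sum_single]
    rw [hsum]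
    refine Submodule.sum_mem _ fun i _ => ?_
    have key : ∀ (u : V) (c : ℂ), D.α i u = c → c ≠ 0 →
        Data.ofJ hJ (Pi.single i (y i)) = ⁅Data.ofU hJ u, Data.ofJ hJ (Pi.single i (y i / c))⁆ := by
      intro u c hu hc
      rw [Data.lie_ofU_ofJ]
      congr 1
      ext j
      rcases eq_or_ne j i with rfl | hj
      · rw [Pi.single_eq_same, Pi.single_eq_same, hu]; field_simp
      · rw [Pi.single_eq_of_ne hj, Pi.single_eq_of_ne hj, mul_zero]
    rcases hN.ne_zero i with h | h
    · rw [key _ _ (hN.α_X₁ i) h]; exact lie_mem_derivedSubspace _ _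
    · rw [key _ _ (hN.α_X₂ i) h]; exact lie_mem_derivedSubspace _ _
  obtain ⟨y, v, rfl⟩ := Data.exists_eq_add_of_mem_ker hx
  refine Submodule.add_mem _ (hJmem y) ?_
  have hf : D.f (X 0) v = a • v := by
    obtain ⟨s, t, rfl⟩ := exists_coords X v
    rw [map_add, map_smul, map_smul, hN.f_X₁, hN.f_X₁, smul_add, smul_comm s, smul_comm t]
  have h := lie_mem_derivedSubspace (Data.ofU hJ (X 0)) (Data.ofR hJ v)
  rw [Data.lie_ofU_ofR, hf, Data.ofR_smul] at h
  exact (Submodule.smul_mem_iff _ hN.a_pos.ne').mp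
    ((Submodule.add_mem_iff_left _ (hJmem _)).mp h)

theorem finrank_model (X : Module.Basis (Fin 2) ℝ V) (hJ : D.Jacobi) :
    Module.finrank ℝ (D.Model hJ) = 2 * (m + 2) := by
  have := Module.Finite.of_basis X
  have hV : Module.finrank ℝ V = 2 := by rw [Module.finrank_eq_card_basis X, Fintype.card_fin]
  change Module.finrank ℝ ((Fin m → ℂ) × V × V) = _
  rw [Module.finrank_prod, Module.finrank_prod, hV, Module.finrank_pi_fintype]
  simp [Complex.finrank_real_complex]
  ring

theorem isTwoStepSKT (hN : IsNormalForm D X a b₁ b₂ z w) (hJ : D.Jacobi) :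
    IsTwoStepSKTNonComplexCodimTwo (Data.metric hJ) (Data.complexStructure hJ) where
  skt := { Data.isHermitian hJ with torsion_closed := hN.torsion_closed hJ }
  two_step := by
    rw [derivedSeries_two_eq_bot_iff, hN.derivedSubspace_eq hJ]
    intro x hx y hy
    obtain ⟨_, _, rfl⟩ := Data.exists_eq_add_of_mem_ker hx
    obtain ⟨_, _, rfl⟩ := Data.exists_eq_add_of_mem_ker hy
    simp
  non_complex h := by
    rw [hN.derivedSubspace_eq hJ, IsComplexSubspace, inf_eq_left] at h
    obtain ⟨x, hx, hx'⟩ := h (show Data.ofR hJ (X 0) ∈ _ from rfl)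
    have h₁ : -x.2.2 = X 0 := congrArg (fun p : Space m V => p.2.1) hx'
    have h₂ : x.2.2 = 0 := hx
    exact X.ne_zero 0 (by rw [← h₁, h₂, neg_zero])
  codim_two := by
    rw [hN.derivedSubspace_eq hJ,
      ((D.projU hJ).quotKerEquivOfSurjective (D.projU_surjective hJ)).finrank_eq,
      Module.finrank_eq_card_basis X, Fintype.card_fin]

end IsNormalForm

end Converse

end SKT

namespace SKT

section StarRing

variable {R : Type*} [Ring R] [StarRing R] {τ : R →+ ℂ}

/-- If the self-commutator of `A` commutes with `A + A*`, then `A` is normal, in a star ring with a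
faithful trace. -/
theorem star_mul_self_comm_of_commute (hτ : ∀ x y, τ (x * y) = τ (y * x))
    (hτ₀ : ∀ x, τ (star x * x) = 0 → x = 0) {A : R}
    (h : Commute (star A * A - A * star A) (A + star A)) : star A * A = A * star A := by
  rw [← sub_eq_zero]
  apply hτ₀
  have hs : star (star A * A - A * star A) = star A * A - A * star A := by
    simp only [star_sub, star_mul, star_star]
  have hc : star A * A - A * star A = (A + star A) * A - A * (A + star A) := by noncomm_ring
  rw [hs]
  generalize star A * A - A * star A = c at *
  calc τ (c * c) = τ (c * (A + star A) * A) - τ (c * A * (A + star A)) := by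
        rw [← map_sub]
        congr 1
        nth_rw 2 [hc]
        noncomm_ring
    _ = 0 := by
        rw [h.eq, hτ (c * A), ← mul_assoc, sub_self]

/-- The Fuglede theorem in a star ring with a faithful trace. -/
theorem star_mul_comm_of_commute (hτ : ∀ x y, τ (x * y) = τ (y * x))
    (hτ₀ : ∀ x, τ (star x * x) = 0 → x = 0) {A B : R} (hA : star A * A = A * star A)
    (hAB : A * B = B * A) : star A * B = B * star A := by
  have hs : star B * star A = star A * star B := by rw [← star_mul, hAB, star_mul]
  rw [eq_comm, ← sub_eq_zero]
  apply hτ₀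
  have e : star (B * star A - star A * B) * (B * star A - star A * B) =
      A * star B * B * star A - A * (star B * star A) * B
        - star B * (A * B) * star A + star B * (A * star A) * B := by
    simp only [star_sub, star_mul, star_star]; noncomm_ring
  have e₁ : τ (A * star B * B * star A) = τ (star A * A * star B * B) := by
    rw [hτ]; congr 1; noncomm_ring
  have e₂ : A * (star B * star A) * B = star A * A * star B * B := by
    rw [hs, hA]; noncomm_ring
  have e₃ : τ (star B * (A * B) * star A) = τ (star A * A * star B * B) := by
    rw [hAB, hA, hτ, ← mul_assoc, ← mul_assoc, hτ]; congr 1; noncomm_ring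
  have e₄ : τ (star B * (A * star A) * B) = τ (star A * A * star B * B) := by
    rw [hτ]
    have : B * (star B * (A * star A)) = B * star B * star A * A := by rw [← hA]; noncomm_ring
    rw [this, hτ, ← mul_assoc, ← mul_assoc, hAB, mul_assoc, mul_assoc, hτ, e₂]
  rw [e, map_add, map_sub, map_sub, e₁, e₂, e₃, e₄]
  ring

end StarRing

section CommonEigenbasis

variable {E : Type*} [NormedAddCommGroup E] [InnerProductSpace ℂ E] [FiniteDimensional ℂ E]

theorem trace_star_mul_self_eq_zero {A : E →ₗ[ℂ] E} (h : LinearMap.trace ℂ E (star A * A) = 0) :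
    A = 0 := by
  let b := stdOrthonormalBasis ℂ E
  rw [LinearMap.trace_eq_sum_inner _ b] at h
  have h₁ : ∑ i, ‖A (b i)‖ ^ 2 = 0 := by
    have : ((∑ i, ‖A (b i)‖ ^ 2 : ℝ) : ℂ) = 0 := by
      rw [← h]
      push_cast
      refine Finset.sum_congr rfl fun i _ => ?_
      rw [Module.End.mul_apply, LinearMap.star_eq_adjoint, LinearMap.adjoint_inner_right,
        inner_self_eq_norm_sq_to_K]
      rfl
    exact_mod_cast this
  refine b.toBasis.ext fun i => ?_
  have := (Finset.sum_eq_zero_iff_of_nonneg (fun i _ => by positivity)).mp h₁ i (Finset.mem_univ i)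
  simpa using this

theorem adjoint_apply_eq_of_normal {A : E →ₗ[ℂ] E} (hA : star A * A = A * star A) {e : E} {z : ℂ}
    (he : A e = z • e) : LinearMap.adjoint A e = conj z • e := by
  have hA' : ∀ x, LinearMap.adjoint A (A x) = A (LinearMap.adjoint A x) := fun x =>
    congrArg (fun T : E →ₗ[ℂ] E => T x) hA
  rw [← sub_eq_zero, ← inner_self_eq_zero (𝕜 := ℂ)]
  have h₁ : inner ℂ (LinearMap.adjoint A e) (LinearMap.adjoint A e) = conj z * z * inner ℂ e e := by
    rw [LinearMap.adjoint_inner_left, ← hA', LinearMap.adjoint_inner_right, he, inner_smul_left,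
      inner_smul_right]
    ring
  have h₂ : inner ℂ (LinearMap.adjoint A e) e = z * inner ℂ e e := by
    rw [LinearMap.adjoint_inner_left, he, inner_smul_right]
  have h₃ : inner ℂ e (LinearMap.adjoint A e) = conj z * inner ℂ e e := by
    rw [LinearMap.adjoint_inner_right, he, inner_smul_left]
  rw [inner_sub_left, inner_sub_right, inner_sub_right, inner_smul_left, inner_smul_right,
    inner_smul_left, inner_smul_right, h₁, h₂, h₃]
  simp only [Complex.conj_conj]
  ring

theorem exists_common_eigenvector {A B : E →ₗ[ℂ] E} (hAB : A * B = B * A) {W : Submodule ℂ E}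
    (hW : W ≠ ⊥) (hA : ∀ x ∈ W, A x ∈ W) (hB : ∀ x ∈ W, B x ∈ W) :
    ∃ e ∈ W, ‖e‖ = 1 ∧ (∃ z : ℂ, A e = z • e) ∧ ∃ w : ℂ, B e = w • e := by
  have key : ∀ {T : E →ₗ[ℂ] E} {U : Submodule ℂ E}, U ≠ ⊥ → (∀ x ∈ U, T x ∈ U) →
      ∃ e ∈ U, e ≠ 0 ∧ ∃ z : ℂ, T e = z • e := by
    intro T U hU hT
    have : Nontrivial U := Submodule.nontrivial_iff_ne_bot.mpr hU
    obtain ⟨z, hz⟩ := Module.End.exists_eigenvalue (T.restrict hT)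
    obtain ⟨e, he⟩ := hz.exists_hasEigenvector
    exact ⟨e, e.2, by simpa using he.2, z, congrArg Subtype.val he.apply_eq_smul⟩
  obtain ⟨e, he, he0, z, hz⟩ := key hW hA
  obtain ⟨e', he', he0', w, hw⟩ := key (T := B) (U := W ⊓ Module.End.eigenspace A z)
    (by
      rw [Submodule.ne_bot_iff]
      exact ⟨e, ⟨he, Module.End.mem_eigenspace_iff.mpr hz⟩, he0⟩)
    (by
      rintro x ⟨hx, hx'⟩
      refine ⟨hB x hx, ?_⟩
      rw [SetLike.mem_coe, Module.End.mem_eigenspace_iff] at hx' ⊢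
      have := congrArg (fun T : E →ₗ[ℂ] E => T x) hAB
      simp only [Module.End.mul_apply] at this
      rw [this, hx', map_smul])
  have hz' := Module.End.mem_eigenspace_iff.mp he'.2
  refine ⟨((‖e'‖⁻¹ : ℝ) : ℂ) • e', W.smul_mem _ he'.1, ?_, ⟨z, ?_⟩, w, ?_⟩
  · rw [norm_smul, Complex.norm_real, norm_inv, norm_norm, inv_mul_cancel₀ (by simpa using he0')]
  · rw [map_smul, hz', smul_comm]
  · rw [map_smul, hw, smul_comm]

theorem exists_common_orthonormal {A B : E →ₗ[ℂ] E} (hAB : A * B = B * A)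
    (hA : star A * A = A * star A) (hB : star B * B = B * star B) (k : ℕ)
    (hk : k ≤ Module.finrank ℂ E) :
    ∃ v : Fin k → E, Orthonormal ℂ v ∧
      ∀ i, (∃ z : ℂ, A (v i) = z • v i) ∧ ∃ w : ℂ, B (v i) = w • v i := by
  induction k with
  | zero => exact ⟨Fin.elim0, ⟨fun i => i.elim0, fun i => i.elim0⟩, fun i => i.elim0⟩
  | succ k ih =>
    obtain ⟨v, hv, hev⟩ := ih (by omega)
    have hinv : ∀ T : E →ₗ[ℂ] E, star T * T = T * star T → (∀ i, ∃ z : ℂ, T (v i) = z • v i) →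
        ∀ x ∈ (Submodule.span ℂ (Set.range v))ᗮ, T x ∈ (Submodule.span ℂ (Set.range v))ᗮ := by
      intro T hT hTv x hx
      rw [Submodule.mem_orthogonal] at hx ⊢
      intro u hu
      induction hu using Submodule.span_induction with
      | mem u hu =>
        obtain ⟨i, rfl⟩ := hu
        obtain ⟨z, hz⟩ := hTv i
        rw [← LinearMap.adjoint_inner_left, adjoint_apply_eq_of_normal hT hz, inner_smul_left,
          hx _ (Submodule.subset_span ⟨i, rfl⟩), mul_zero]
      | zero => exact inner_zero_left _
      | add u u' _ _ h h' => rw [inner_add_left, h, h', add_zero]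
      | smul c u _ h => rw [inner_smul_left, h, mul_zero]
    have hne : (Submodule.span ℂ (Set.range v))ᗮ ≠ ⊥ := by
      intro h
      rw [Submodule.orthogonal_eq_bot_iff] at h
      have := finrank_span_eq_card hv.linearIndependent
      rw [h, finrank_top, Fintype.card_fin] at this
      omega
    obtain ⟨e, he, hne, hze, hwe⟩ := exists_common_eigenvector hAB hne
      (hinv A hA fun i => (hev i).1) (hinv B hB fun i => (hev i).2)
    have hve : ∀ i, inner ℂ (v i) e = 0 := fun i =>
      he _ (Submodule.subset_span ⟨i, rfl⟩)
    refine ⟨Fin.snoc v e, ?_, ?_⟩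
    · rw [orthonormal_iff_ite] at hv ⊢
      intro i j
      induction i using Fin.lastCases with
      | last =>
        induction j using Fin.lastCases with
        | last => simp [hne]
        | cast j =>
          rw [Fin.snoc_last, Fin.snoc_castSucc, inner_eq_zero_symm.mp (hve j), if_neg]
          exact (Fin.castSucc_lt_last j).ne'
      | cast i =>
        induction j using Fin.lastCases with
        | last =>
          rw [Fin.snoc_last, Fin.snoc_castSucc, hve i, if_neg]
          exact (Fin.castSucc_lt_last i).ne
        | cast j => simp [hv i j]
    · intro i
      induction i using Fin.lastCases with
      | last => simpa using ⟨hze, hwe⟩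
      | cast i => simpa using hev i

end CommonEigenbasis

end SKT

namespace SKT

section NormalPair

variable {E : Type*} [NormedAddCommGroup E] [InnerProductSpace ℂ E] [FiniteDimensional ℂ E]

theorem normal_of_relations {A B : E →ₗ[ℂ] E} (hAB : A * B = B * A) {a b₁ b₂ : ℂ}
    (hA : (A + star A) * A + star A * (A + star A) + a • (A + star A) = 0)
    (hB : (B + star B) * B + star B * (B + star B) + b₁ • (A + star A) + b₂ • (B + star B) = 0) :
    star A * A = A * star A ∧ star B * B = B * star B := by
  have hτ : ∀ x y : E →ₗ[ℂ] E, (LinearMap.trace ℂ E).toAddMonoidHom (x * y) =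
      (LinearMap.trace ℂ E).toAddMonoidHom (y * x) := LinearMap.trace_mul_comm ℂ
  have hτ₀ : ∀ x : E →ₗ[ℂ] E, (LinearMap.trace ℂ E).toAddMonoidHom (star x * x) = 0 → x = 0 :=
    fun x h => trace_star_mul_self_eq_zero h
  have comm : ∀ T : E →ₗ[ℂ] E, star T * T - T * star T =
      (T + star T) * T + star T * (T + star T) - (T + star T) * (T + star T) := fun T => by
    noncomm_ring
  have nA : star A * A = A * star A := by
    refine star_mul_self_comm_of_commute hτ hτ₀ ?_
    rw [comm, eq_neg_of_add_eq_zero_left hA]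
    exact (((Commute.refl _).smul_left a).neg_left).sub_left ((Commute.refl _).mul_left (.refl _))
  refine ⟨nA, star_mul_self_comm_of_commute hτ hτ₀ ?_⟩
  have h₁ : Commute A B := hAB
  have h₂ : Commute (star A) B := star_mul_comm_of_commute hτ hτ₀ nA hAB
  have h₃ : Commute A (star B) := by simpa using h₂.star_star
  have hST : Commute (A + star A) (B + star B) :=
    (h₁.add_left h₂).add_right (h₃.add_left h₁.star_star)
  have hB' : (B + star B) * B + star B * (B + star B) =
      -(b₁ • (A + star A) + b₂ • (B + star B)) := by
    rw [eq_neg_iff_add_eq_zero, ← hB]; abel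
  rw [comm, hB']
  exact (((hST.smul_left b₁).add_left ((Commute.refl _).smul_left b₂)).neg_left).sub_left
    ((Commute.refl _).mul_left (.refl _))

end NormalPair

section RealForms

variable {H : Type*} [AddCommGroup H] [Module ℝ H] [Module.Finite ℝ H]
  {g : LinearMap.BilinForm ℝ H} {J : H →ₗ[ℝ] H}

/-- A Hermitian structure on a real vector space is the standard one in suitable coordinates. -/
theorem exists_unitary_coordinates (symm : ∀ x y, g x y = g y x) (pos : ∀ x, x ≠ 0 → 0 < g x x)
    (sq : ∀ x, J (J x) = -x) (orth : ∀ x y, g (J x) (J y) = g x y) :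
    ∃ (m : ℕ) (φ : H ≃ₗ[ℝ] EuclideanSpace ℂ (Fin m)), (∀ x, φ (J x) = Complex.I • φ x) ∧
      ∀ x y, g x y = (inner ℂ (φ x) (φ y)).re := by
  have hJ : J * J = -1 := LinearMap.ext sq
  let : Module ℂ H := Module.compHom H (Complex.lift ⟨J, hJ⟩).toRingHom
  have smul_def : ∀ (c : ℂ) (x : H), c • x = c.re • x + c.im • J x := fun c x => by
    change (Complex.lift ⟨J, hJ⟩ c) x = _
    simp [Complex.lift, Complex.liftAux_apply]
  have hskew : ∀ x y, g x (J y) = -g (J x) y := fun x y => by rw [← orth x, sq, map_neg]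
  have hJx : ∀ x, g (J x) x = 0 := fun x => by
    have h₁ := hskew x x
    rw [symm x (J x)] at h₁
    linarith
  have nonneg : ∀ x, 0 ≤ g x x := fun x => by
    rcases eq_or_ne x 0 with rfl | hx
    · simp
    · exact (pos x hx).le
  let core : InnerProductSpace.Core ℂ H :=
    { inner := fun x y => ⟨g x y, g (J x) y⟩
      conj_inner_symm := fun x y => Complex.ext (symm y x) (by
        change -g (J y) x = g (J x) y
        rw [← hskew, symm])
      re_inner_nonneg := nonneg
      add_left := fun x y z => Complex.ext (by simp) (by simp)
      smul_left := fun x y c => by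
        refine Complex.ext ?_ ?_
        · simp [smul_def]
        · simp [smul_def, sq]
      definite := fun x hx => by
        by_contra hne
        exact (pos x hne).ne' (congrArg Complex.re hx) }
  let : NormedAddCommGroup H := core.toNormedAddCommGroup
  let : InnerProductSpace ℂ H := InnerProductSpace.ofCore core.toCore
  have : IsScalarTower ℝ ℂ H := ⟨fun r c x => by
    simp [smul_def, smul_smul]⟩
  have : Module.Finite ℂ H := Module.Finite.of_restrictScalars_finite ℝ ℂ H
  let b := stdOrthonormalBasis ℂ H
  refine ⟨_, b.repr.toLinearEquiv.restrictScalars ℝ, fun x => ?_, fun x y => ?_⟩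
  · have : J x = Complex.I • x := by simp [smul_def]
    rw [this]
    exact map_smul b.repr Complex.I x
  · change _ = (inner ℂ (b.repr x) (b.repr y)).re
    rw [b.repr.inner_map_map]
    rfl

/-- Two commuting complex linear maps whose Hermitian parts satisfy the relations imposed by closed
torsion are simultaneously diagonal in suitable unitary coordinates. -/
theorem exists_diagonalizing_coordinates (symm : ∀ x y, g x y = g y x)
    (pos : ∀ x, x ≠ 0 → 0 < g x x) (sq : ∀ x, J (J x) = -x)
    (orth : ∀ x y, g (J x) (J y) = g x y) {A B : H →ₗ[ℝ] H} (hA : ∀ x, A (J x) = J (A x))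
    (hB : ∀ x, B (J x) = J (B x)) (hAB : ∀ x, A (B x) = B (A x)) {a b₁ b₂ : ℝ}
    (h₁ : ∀ x y, g (A (A x)) y + 2 * g (A x) (A y) + g x (A (A y))
      + a * (g (A x) y + g x (A y)) = 0)
    (h₂ : ∀ x y, g (B (B x)) y + 2 * g (B x) (B y) + g x (B (B y))
      + b₁ * (g (A x) y + g x (A y)) + b₂ * (g (B x) y + g x (B y)) = 0) :
    ∃ (m : ℕ) (φ : H ≃ₗ[ℝ] (Fin m → ℂ)) (z w : Fin m → ℂ), (∀ x, φ (J x) = Complex.I • φ x) ∧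
      (∀ x y, g x y = Data.innerJ (φ x) (φ y)) ∧ (∀ x i, φ (A x) i = z i * φ x i) ∧
      ∀ x i, φ (B x) i = w i * φ x i := by
  obtain ⟨m, φ, hφJ, hφg⟩ := exists_unitary_coordinates symm pos sq orth
  have hsymm : ∀ (c : ℂ) (y : EuclideanSpace ℂ (Fin m)),
      c • y = c.re • y + c.im • (Complex.I • y) := fun c y => by
    conv_lhs => rw [← Complex.re_add_im c]
    rw [add_smul, mul_smul]
    rfl
  have hφJ' : ∀ y, φ.symm (Complex.I • y) = J (φ.symm y) := fun y => by
    rw [LinearEquiv.symm_apply_eq, hφJ, LinearEquiv.apply_symm_apply]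
  let conjugate (T : H →ₗ[ℝ] H) (hT : ∀ x, T (J x) = J (T x)) :
      EuclideanSpace ℂ (Fin m) →ₗ[ℂ] EuclideanSpace ℂ (Fin m) :=
    { toFun := fun y => φ (T (φ.symm y))
      map_add' := fun y y' => by simp
      map_smul' := fun c y => by
        simp only [RingHom.id_apply]
        rw [hsymm c y, hsymm c (φ (T (φ.symm y)))]
        simp only [map_add, map_smul, hφJ', hT, hφJ] }
  have hconj : ∀ T hT x, conjugate T hT (φ x) = φ (T x) := fun T hT x => by
    change φ (T (φ.symm (φ x))) = _
    rw [LinearEquiv.symm_apply_apply]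
  have op_zero : ∀ T : EuclideanSpace ℂ (Fin m) →ₗ[ℂ] EuclideanSpace ℂ (Fin m),
      (∀ x y, (inner ℂ (T (φ x)) (φ y)).re = 0) → T = 0 := fun T hT => by
    ext1 y
    have := hT (φ.symm y) (φ.symm (T y))
    rw [LinearEquiv.apply_symm_apply, LinearEquiv.apply_symm_apply] at this
    have h := inner_self_eq_norm_sq (𝕜 := ℂ) (T y)
    change (inner ℂ (T y) (T y)).re = _ at h
    rw [this] at h
    simpa using h.symm
  have hstar : ∀ (T : EuclideanSpace ℂ (Fin m) →ₗ[ℂ] EuclideanSpace ℂ (Fin m)) x y,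
      inner ℂ ((star T) x) y = inner ℂ x (T y) := fun T x y => by
    rw [LinearMap.star_eq_adjoint, LinearMap.adjoint_inner_left]
  set A' := conjugate A hA with hA'
  set B' := conjugate B hB with hB'
  have hcomm : A' * B' = B' * A' := by
    ext1 y
    obtain ⟨x, rfl⟩ := φ.surjective y
    simp only [Module.End.mul_apply, hA', hB', hconj, hAB]
  obtain ⟨nA, nB⟩ := normal_of_relations (a := a) (b₁ := b₁) (b₂ := b₂) hcomm
    (op_zero _ fun x y => by
      simp only [LinearMap.add_apply, Module.End.mul_apply, LinearMap.smul_apply, inner_add_left,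
        hstar, inner_smul_left, hA', hconj, map_add, Complex.add_re,
        Complex.conj_ofReal, Complex.re_ofReal_mul, ← hφg]
      linear_combination h₁ x y)
    (op_zero _ fun x y => by
      simp only [LinearMap.add_apply, Module.End.mul_apply, LinearMap.smul_apply, inner_add_left,
        hstar, inner_smul_left, hA', hB', hconj, map_add, Complex.add_re,
        Complex.conj_ofReal, Complex.re_ofReal_mul, ← hφg]
      linear_combination h₂ x y)
  obtain ⟨v, hv, hev⟩ := exists_common_orthonormal hcomm nA nB m (by simp)
  let b : OrthonormalBasis (Fin m) ℂ (EuclideanSpace ℂ (Fin m)) :=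
    OrthonormalBasis.mk hv (by
      rw [hv.linearIndependent.span_eq_top_of_card_eq_finrank' (by simp)])
  have hb : ∀ i, b i = v i := fun i => by simp [b]
  choose z hz using fun i => (hev i).1
  choose w hw using fun i => (hev i).2
  have diag : ∀ (T : EuclideanSpace ℂ (Fin m) →ₗ[ℂ] EuclideanSpace ℂ (Fin m)) (c : Fin m → ℂ),
      (∀ i, T (v i) = c i • v i) → ∀ y i, b.repr (T y) i = c i * b.repr y i := by
    intro T c hc y i
    rw [b.repr_apply_apply, b.repr_apply_apply, hb]
    conv_lhs => rw [← b.sum_repr y]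
    simp only [map_sum, map_smul, hb, hc, b.repr_apply_apply, inner_sum, inner_smul_right]
    rw [Finset.sum_eq_single i]
    · rw [orthonormal_iff_ite.mp hv i i]; simp; ring
    · intro j _ hj
      rw [orthonormal_iff_ite.mp hv i j, if_neg hj.symm]; simp
    · simp
  refine ⟨m, (φ.trans (b.repr.toLinearEquiv.restrictScalars ℝ)).trans
    ((WithLp.linearEquiv 2 ℂ (Fin m → ℂ)).restrictScalars ℝ), z, w, fun x => ?_, fun x y => ?_,
    fun x i => ?_, fun x i => ?_⟩
  · change (b.repr (φ (J x))).ofLp = Complex.I • (b.repr (φ x)).ofLp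
    rw [hφJ, map_smul]
    rfl
  · rw [hφg, ← b.repr.inner_map_map, PiLp.inner_apply, Complex.re_sum]
    refine Finset.sum_congr rfl fun i _ => ?_
    change ((b.repr (φ y)) i * conj ((b.repr (φ x)) i)).re = _
    rw [mul_comm]
    rfl
  · change b.repr (φ (A x)) i = z i * b.repr (φ x) i
    rw [← hconj A hA, diag _ z hz]
  · change b.repr (φ (B x)) i = w i * b.repr (φ x) i
    rw [← hconj B hB, diag _ w hw]

end RealForms

/-- A commutative associative algebra of dimension two that is spanned by products is unital. -/
theorem exists_unit_of_span_products {V : Type*} [AddCommGroup V] [Module ℝ V]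
    (X : Module.Basis (Fin 2) ℝ V) {f : V →ₗ[ℝ] V →ₗ[ℝ] V} (symm : ∀ x y, f x y = f y x)
    (comm : ∀ x y z, f x (f y z) = f y (f x z))
    (hspan : ∀ S : Submodule ℝ V, (∀ x y, f x y ∈ S) → S = ⊤) : ∃ E, ∀ x, f E x = x := by
  have assoc : ∀ x y z, f (f x y) z = f x (f y z) := fun x y z => by
    rw [symm _ z, comm, symm z y]
  let Φ : V × V →ₗ[ℝ] V := (f.flip (X 0)).coprod (f.flip (X 1))
  have hΦ : LinearMap.range Φ = ⊤ := hspan _ fun x y => by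
    obtain ⟨s, t, rfl⟩ := exists_coords X y
    exact ⟨(s • x, t • x), by simp [Φ]⟩
  obtain ⟨⟨p, q⟩, h₀⟩ := LinearMap.range_eq_top.mp hΦ (X 0)
  obtain ⟨⟨r, s⟩, h₁⟩ := LinearMap.range_eq_top.mp hΦ (X 1)
  replace h₀ : f p (X 0) + f q (X 1) = X 0 := h₀
  replace h₁ : f r (X 0) + f s (X 1) = X 1 := h₁
  have e₀ : f s (f p (X 0)) + f s (f q (X 1)) = f s (X 0) := by rw [← map_add, h₀]
  have e₁ : f q (f r (X 0)) + f q (f s (X 1)) = f q (X 1) := by rw [← map_add, h₁]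
  have e₂ : f p (f r (X 0)) + f p (f s (X 1)) = f p (X 1) := by rw [← map_add, h₁]
  have e₃ : f r (f p (X 0)) + f r (f q (X 1)) = f r (X 0) := by rw [← map_add, h₀]
  refine ⟨p + s - f p s + f q r, fun x => ?_⟩
  suffices h : f (p + s - f p s + f q r) = LinearMap.id by rw [h]; rfl
  refine X.ext fun j => ?_
  simp only [map_add, map_sub, LinearMap.add_apply, LinearMap.sub_apply, assoc,
    LinearMap.id_apply]
  fin_cases j
  · change f p (X 0) + f s (X 0) - f p (f s (X 0)) + f q (f r (X 0)) = X 0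
    rw [comm p s, ← e₀, comm s q, ← sub_eq_zero]
    have e : f q (f s (X 1)) = f q (X 1) - f q (f r (X 0)) := eq_sub_of_add_eq' e₁
    rw [e]
    nth_rw 6 [← h₀]
    abel
  · change f p (X 1) + f s (X 1) - f p (f s (X 1)) + f q (f r (X 1)) = X 1
    rw [← e₂, comm p r, comm q r, ← sub_eq_zero]
    have e : f r (f p (X 0)) = f r (X 0) - f r (f q (X 1)) := eq_sub_of_add_eq e₃
    rw [e]
    nth_rw 6 [← h₁]
    abel

end SKT

namespace SKT

section NormalFormOfClosed

variable {m : ℕ} {V : Type*} [AddCommGroup V] [Module ℝ V] {D : Data m V}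
  {X : Module.Basis (Fin 2) ℝ V} {a b₁ b₂ : ℝ} {z w : Fin m → ℂ}

theorem Data.jacobi_identity (hJ : D.Jacobi) (i : Fin m) (u u' v : V) :
    D.α i u * D.h u' v i + D.h u (D.f u' v) i = D.α i u' * D.h u v i + D.h u' (D.f u v) i := by
  have h := congrFun (congrArg Prod.fst (hJ (0, 0, u) (0, 0, u') (0, v, 0))) i
  simp [Data.bracket, Data.h₂] at h
  linear_combination h

theorem eq_zero_of_sum_conj_mul_re {c : Fin m → ℂ}
    (h : ∀ y : Fin m → ℂ, ∑ i, (conj (c i) * y i).re = 0) (i : Fin m) : c i = 0 := by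
  by_contra hi
  exact (Data.innerJ_self_pos (y := c) fun hc => hi (congrFun hc i)).ne' (h c)

theorem componentEquations_of_closed (hf₁ : ∀ j, D.f (X 0) (X j) = a • X j)
    (hf₂ : D.f (X 1) (X 1) = b₁ • X 0 + b₂ • X 1) (hα₁ : ∀ i, D.α i (X 0) = z i)
    (hα₂ : ∀ i, D.α i (X 1) = w i) (hJ : D.Jacobi)
    (hT : ∀ x₁ x₂ x₃ x₄ : D.Model hJ,
      extDeriv₃ (torsionForm (Data.metric hJ) (Data.complexStructure hJ)) x₁ x₂ x₃ x₄ = 0)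
    (i : Fin m) :
    ComponentEquations a b₁ b₂ (z i) (w i) (D.h (X 0) (X 0) i) (D.h (X 0) (X 1) i)
      (D.h (X 1) (X 0) i) (D.h (X 1) (X 1) i) := by
  have hf₃ : D.f (X 1) (X 0) = a • X 1 := by rw [D.f_symm, hf₁]
  have hre : ∀ u v, 4 * (D.α i u).re * (D.α i v).re + 2 * (D.α i (D.f u v)).re = 0 := by
    intro u v
    have h := hT (Data.ofU hJ u) (Data.ofR hJ v) (Data.ofJ hJ (Pi.single i 1))
      (Data.ofJ hJ (Pi.single i Complex.I))
    rw [Data.extDeriv_URJJ, neg_eq_zero, Finset.sum_eq_single i] at h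
    · simpa using h
    · intro j _ hj
      simp [hj]
    · simp
  have hURRJ := fun u v v' => eq_zero_of_sum_conj_mul_re fun y => by
    have h := hT (Data.ofU hJ u) (Data.ofR hJ v) (Data.ofR hJ v') (Data.ofJ hJ y)
    rw [Data.extDeriv_URRJ, neg_eq_zero] at h
    exact h
  have hUURJ := fun u u' v => eq_zero_of_sum_conj_mul_re fun y => by
    have h := hT (Data.ofU hJ u) (Data.ofU hJ u') (Data.ofR hJ v) (Data.ofJ hJ y)
    rw [Data.extDeriv_UURJ, neg_eq_zero] at h
    exact h
  refine ⟨?_, ?_, ?_, ?_, ?_, ?_, ?_, ?_, ?_⟩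
  · have h := D.jacobi_identity hJ i (X 0) (X 1) (X 0)
    simp only [hf₁, hf₃, hα₁, hα₂, map_smul, Pi.smul_apply, Complex.real_smul] at h
    exact h
  · have h := D.jacobi_identity hJ i (X 0) (X 1) (X 1)
    simp only [hf₁, hf₂, hα₁, hα₂, map_smul, map_add, Pi.add_apply, Pi.smul_apply,
      Complex.real_smul] at h
    linear_combination h
  · have h := hre (X 0) (X 0)
    rwa [hf₁, map_smul, hα₁, Complex.smul_re, smul_eq_mul] at h
  · have h := hre (X 0) (X 1)
    rwa [hf₁, map_smul, hα₁, hα₂, Complex.smul_re, smul_eq_mul] at h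
  · have h := hre (X 1) (X 1)
    rwa [hf₂, map_add, map_smul, map_smul, hα₁, hα₂, Complex.add_re, Complex.smul_re,
      Complex.smul_re, smul_eq_mul, smul_eq_mul] at h
  · have h := (mul_eq_zero.mp (hURRJ (X 0) (X 0) (X 1) i)).resolve_left Complex.I_ne_zero
    simp only [hf₁, hα₁, hα₂, map_smul, LinearMap.smul_apply, Pi.smul_apply,
      Complex.real_smul] at h
    linear_combination h
  · have h := (mul_eq_zero.mp (hURRJ (X 1) (X 0) (X 1) i)).resolve_left Complex.I_ne_zero
    simp only [hf₂, hf₃, hα₁, hα₂, map_smul, map_add, LinearMap.add_apply, Pi.add_apply,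
      LinearMap.smul_apply, Pi.smul_apply, Complex.real_smul] at h
    linear_combination h
  · have h := hUURJ (X 0) (X 1) (X 0) i
    simp only [hf₁, hf₃, hα₁, hα₂, map_smul, LinearMap.smul_apply, Pi.smul_apply,
      Complex.real_smul] at h
    linear_combination h
  · have h := hUURJ (X 0) (X 1) (X 1) i
    simp only [hf₁, hf₂, hα₁, hα₂, map_smul, map_add, LinearMap.add_apply, Pi.add_apply,
      LinearMap.smul_apply, Pi.smul_apply, Complex.real_smul] at h
    linear_combination h

/-- If `α_i = 0`, then `Y_i` is not in the derived algebra. -/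
theorem ne_zero_of_mem_derived (ha : 0 < a) (hf₁ : ∀ j, D.f (X 0) (X j) = a • X j)
    (hf₂ : D.f (X 1) (X 1) = b₁ • X 0 + b₂ • X 1) (hα₁ : ∀ i, D.α i (X 0) = z i)
    (hα₂ : ∀ i, D.α i (X 1) = w i) (hJ : D.Jacobi) (i : Fin m)
    (h : ComponentEquations a b₁ b₂ (z i) (w i) (D.h (X 0) (X 0) i) (D.h (X 0) (X 1) i)
      (D.h (X 1) (X 0) i) (D.h (X 1) (X 1) i))
    (hder : Data.ofJ hJ (Pi.single i 1) ∈ derivedSubspace (D.Model hJ)) :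
    z i ≠ 0 ∨ w i ≠ 0 := by
  by_contra hcon
  push Not at hcon
  obtain ⟨hz, hw⟩ := hcon
  have ha' : (a : ℂ) ≠ 0 := by exact_mod_cast ha.ne'
  have hf₃ : D.f (X 1) (X 0) = a • X 1 := by rw [D.f_symm, hf₁]
  set p := D.h (X 0) (X 0) i
  set q := D.h (X 0) (X 1) i with hq
  have hqr : D.h (X 1) (X 0) i = q := by
    have := h.skew₁
    rw [hz, hw] at this
    have h' : (a : ℂ) * (q - D.h (X 1) (X 0) i) = 0 := by
      simp only [map_zero, Complex.zero_re, Complex.ofReal_zero] at this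
      linear_combination this / 2
    exact (sub_eq_zero.mp ((mul_eq_zero.mp h').resolve_left ha')).symm
  have hs : b₁ * p + b₂ * q = a * D.h (X 1) (X 1) i := by
    have := h.jacobi₂
    rw [hz, hw] at this
    linear_combination this
  let ℓ : V →ₗ[ℝ] ℂ := (X.coord 0).smulRight p + (X.coord 1).smulRight q
  have hℓ₀ : ℓ (X 0) = p := by simp [ℓ]
  have hℓ₁ : ℓ (X 1) = q := by simp [ℓ]
  have hα : ∀ u, D.α i u = 0 := fun u => by
    obtain ⟨s, t, rfl⟩ := exists_coords X u
    rw [map_add, map_smul, map_smul, hα₁, hα₂, hz, hw, smul_zero, smul_zero, add_zero]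
  have hfh : ∀ u v, a * D.h u v i = ℓ (D.f u v) := fun u v => by
    obtain ⟨s, t, rfl⟩ := exists_coords X u
    obtain ⟨s', t', rfl⟩ := exists_coords X v
    simp only [map_add, map_smul, LinearMap.add_apply, LinearMap.smul_apply, Pi.add_apply,
      Pi.smul_apply, Complex.real_smul, hf₁, hf₂, hf₃, hℓ₀, hℓ₁, hqr]
    linear_combination -(t * t') * hs
  have hsymm : ∀ u v, D.h u v i = D.h v u i := fun u v => mul_left_cancel₀ ha' (by
    rw [hfh, hfh, D.f_symm])
  let Λ : D.Model hJ →ₗ[ℝ] ℂ :=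
    (a • (LinearMap.proj i ∘ₗ LinearMap.fst ℝ (Fin m → ℂ) (V × V))
      - ℓ ∘ₗ LinearMap.fst ℝ V V ∘ₗ LinearMap.snd ℝ (Fin m → ℂ) (V × V) :
        Space m V →ₗ[ℝ] ℂ)
  have hΛ : ∀ x : D.Model hJ, Λ x = a * x.1 i - ℓ x.2.1 := fun x => rfl
  have hle : derivedSubspace (D.Model hJ) ≤ LinearMap.ker Λ := derivedSubspace_le fun x y => by
    rw [LinearMap.mem_ker, hΛ]
    simp only [Data.lie_def, Data.bracket, hα, Data.h₂, Pi.smul_apply, Pi.sub_apply,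
      hsymm x.2.2 y.2.2, map_sub, ← hfh, smul_eq_mul]
    ring
  have h0 := hle hder
  rw [LinearMap.mem_ker, hΛ] at h0
  simp [Data.ofJ, ha.ne'] at h0

theorem isNormalForm_of_closed (horth : ∀ j k, D.g₀ (X j) (X k) = if j = k then 1 else 0)
    (ha : 0 < a) (hb₂ : 0 ≤ b₂) (hf₁ : ∀ j, D.f (X 0) (X j) = a • X j)
    (hf₂ : D.f (X 1) (X 1) = b₁ • X 0 + b₂ • X 1) (hα₁ : ∀ i, D.α i (X 0) = z i)
    (hα₂ : ∀ i, D.α i (X 1) = w i) (hJ : D.Jacobi)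
    (hT : ∀ x₁ x₂ x₃ x₄ : D.Model hJ,
      extDeriv₃ (torsionForm (Data.metric hJ) (Data.complexStructure hJ)) x₁ x₂ x₃ x₄ = 0)
    (hder : ∀ y, Data.ofJ hJ y ∈ derivedSubspace (D.Model hJ)) :
    IsNormalForm D X a b₁ b₂ z w where
  orthonormal := horth
  a_pos := ha
  b₂_nonneg := hb₂
  f_X₁ := hf₁
  f_X₂ := hf₂
  α_X₁ := hα₁
  α_X₂ := hα₂
  norm_condition := by
    have h := hT (Data.ofU hJ (X 0)) (Data.ofU hJ (X 1)) (Data.ofR hJ (X 0)) (Data.ofR hJ (X 1))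
    rw [Data.extDeriv_UURR] at h
    simp only [hf₁, hf₂, map_smul, map_add, LinearMap.add_apply,
      LinearMap.smul_apply, horth, smul_eq_mul] at h
    rw [Data.innerJ_comm (D.h (X 1) (X 1)) (D.h (X 0) (X 0))] at h
    norm_num at h
    linear_combination -h
  cases i := by
    have h := componentEquations_of_closed hf₁ hf₂ hα₁ hα₂ hJ hT i
    exact h.cases ha (ne_zero_of_mem_derived ha hf₁ hf₂ hα₁ hα₂ hJ i h (hder _))

end NormalFormOfClosed

end SKT

namespace SKT

section Structure

variable {L : Type*} [LieRing L] [LieAlgebra ℝ L]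

/-- The maximal complex subspace `𝔞_J = 𝔤' ∩ J𝔤'` of the derived algebra. -/
def complexCore (J : L →ₗ[ℝ] L) : Submodule ℝ L :=
  derivedSubspace L ⊓ (derivedSubspace L).comap J

/-- The orthogonal complement `𝔞_r` of the maximal complex subspace in the derived algebra. -/
def realPart (g : LinearMap.BilinForm ℝ L) (J : L →ₗ[ℝ] L) : Submodule ℝ L :=
  derivedSubspace L ⊓ g.orthogonal (complexCore J)

variable {g : LinearMap.BilinForm ℝ L} {J : L →ₗ[ℝ] L}

namespace IsTwoStepSKTNonComplexCodimTwo

theorem lie_eq_zero (h : IsTwoStepSKTNonComplexCodimTwo g J) {x y : L}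
    (hx : x ∈ derivedSubspace L) (hy : y ∈ derivedSubspace L) : ⁅x, y⁆ = 0 :=
  derivedSeries_two_eq_bot_iff.mp h.two_step x hx y hy

theorem J_mem_complexCore (h : IsTwoStepSKTNonComplexCodimTwo g J) {x : L}
    (hx : x ∈ complexCore J) : J x ∈ complexCore J :=
  ⟨hx.2, by
    change J (J x) ∈ derivedSubspace L
    rw [h.skt.sq]; exact neg_mem hx.1⟩

theorem lie_J_J (h : IsTwoStepSKTNonComplexCodimTwo g J) {x y : L}
    (hx : x ∈ derivedSubspace L) (hy : y ∈ derivedSubspace L) :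
    ⁅J x, J y⁆ = J (⁅J x, y⁆ - ⁅J y, x⁆) := by
  have h₁ := h.skt.integrable x y
  rw [h.lie_eq_zero hx hy, ← lie_skew x (J y), map_neg, sub_zero, sub_neg_eq_add] at h₁
  rw [map_sub, ← sub_eq_zero, ← h₁]
  abel

theorem lie_sub_mem (h : IsTwoStepSKTNonComplexCodimTwo g J) {x y : L}
    (hx : x ∈ derivedSubspace L) (hy : y ∈ derivedSubspace L) :
    ⁅J x, y⁆ - ⁅J y, x⁆ ∈ complexCore J :=
  ⟨sub_mem (lie_mem_derivedSubspace _ _) (lie_mem_derivedSubspace _ _), by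
    change J _ ∈ derivedSubspace L
    rw [← h.lie_J_J hx hy]; exact lie_mem_derivedSubspace _ _⟩

theorem lie_J_core (h : IsTwoStepSKTNonComplexCodimTwo g J) {x k : L}
    (hx : x ∈ derivedSubspace L) (hk : k ∈ complexCore J) : ⁅J x, J k⁆ = J ⁅J x, k⁆ := by
  rw [h.lie_J_J hx hk.1, ← lie_skew (J k) x, h.lie_eq_zero hx hk.2, neg_zero, sub_zero]

theorem lie_mem_complexCore (h : IsTwoStepSKTNonComplexCodimTwo g J) {x k : L}
    (hx : x ∈ derivedSubspace L) (hk : k ∈ complexCore J) : ⁅J x, k⁆ ∈ complexCore J :=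
  ⟨lie_mem_derivedSubspace _ _, by
    change J _ ∈ derivedSubspace L
    rw [← h.lie_J_core hx hk]; exact lie_mem_derivedSubspace _ _⟩

theorem lie_comm (h : IsTwoStepSKTNonComplexCodimTwo g J) (x y : L) {v : L}
    (hv : v ∈ derivedSubspace L) : ⁅x, ⁅y, v⁆⁆ = ⁅y, ⁅x, v⁆⁆ := by
  rw [leibniz_lie x y v, h.lie_eq_zero (lie_mem_derivedSubspace x y) hv, zero_add]

theorem eq_zero_of_apply_self (h : IsTwoStepSKTNonComplexCodimTwo g J) {x : L} (hx : g x x = 0) :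
    x = 0 := by
  by_contra hne
  exact (h.skt.pos x hne).ne' hx

theorem eq_zero_of_mem (h : IsTwoStepSKTNonComplexCodimTwo g J) {x : L}
    (hx : x ∈ complexCore J) (hx' : x ∈ realPart g J) : x = 0 :=
  h.eq_zero_of_apply_self (hx'.2 x hx)

variable [Module.Finite ℝ L]

theorem isCompl_orthogonal (h : IsTwoStepSKTNonComplexCodimTwo g J) (W : Submodule ℝ L) :
    IsCompl W (g.orthogonal W) := by
  have hrefl : g.IsRefl := fun x y hxy => by rw [h.skt.symm, hxy]
  rw [LinearMap.BilinForm.isCompl_orthogonal_iff_disjoint hrefl, Submodule.disjoint_def]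
  exact fun x hx hx' => h.eq_zero_of_apply_self (hx' x hx)

theorem exists_core_add_real (h : IsTwoStepSKTNonComplexCodimTwo g J) {x : L}
    (hx : x ∈ derivedSubspace L) : ∃ k ∈ complexCore J, ∃ c ∈ realPart g J, k + c = x := by
  obtain ⟨k, hk, c, hc, rfl⟩ := Submodule.mem_sup.mp
    ((h.isCompl_orthogonal (complexCore J)).sup_eq_top ▸ Submodule.mem_top (x := x))
  exact ⟨k, hk, c, ⟨(Submodule.add_mem_iff_right _ hk.1).mp hx, hc⟩, rfl⟩

theorem even_finrank_complexCore (h : IsTwoStepSKTNonComplexCodimTwo g J) :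
    ∃ m, Module.finrank ℝ (complexCore J) = 2 * m := by
  obtain ⟨m, φ, -⟩ := exists_unitary_coordinates (H := complexCore J)
    (g := g.restrict (complexCore J)) (J := J.restrict fun x hx => h.J_mem_complexCore hx)
    (fun x y => h.skt.symm x y) (fun x hx => h.skt.pos x (by simpa using hx))
    (fun x => Subtype.ext (h.skt.sq x)) (fun x y => h.skt.orthogonal x y)
  refine ⟨m, ?_⟩
  rw [φ.finrank_eq, ← Module.finrank_mul_finrank ℝ ℂ, Complex.finrank_real_complex,
    finrank_euclideanSpace_fin]

theorem dimensions (h : IsTwoStepSKTNonComplexCodimTwo g J) {n : ℕ}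
    (hn : Module.finrank ℝ L = 2 * n) :
    2 ≤ n ∧ Module.finrank ℝ (complexCore J) = 2 * (n - 2) ∧
      Module.finrank ℝ (realPart g J) = 2 ∧
      derivedSubspace L ⊔ (derivedSubspace L).comap J = ⊤ := by
  let e : L ≃ₗ[ℝ] L := LinearEquiv.ofLinearMap J (-J)
    (LinearMap.ext fun x => by simp [h.skt.sq]) (LinearMap.ext fun x => by simp [h.skt.sq])
  have hcomap : (derivedSubspace L).comap J = (derivedSubspace L).map e.symm.toLinearMap :=
    (Submodule.map_equiv_eq_comap_symm e.symm _).symm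
  have hmap : (derivedSubspace L).comap J = (derivedSubspace L).map J := by
    ext x
    refine ⟨fun hx => ⟨-J x, neg_mem hx, by rw [map_neg, h.skt.sq, neg_neg]⟩, ?_⟩
    rintro ⟨y, hy, rfl⟩
    change J (J y) ∈ derivedSubspace L
    rw [h.skt.sq]; exact neg_mem hy
  have d₁ : Module.finrank ℝ ((derivedSubspace L).comap J) =
      Module.finrank ℝ (derivedSubspace L) := by
    rw [hcomap, LinearEquiv.finrank_map_eq]
  have d₂ := Submodule.finrank_sup_add_finrank_inf_eq (derivedSubspace L)
    ((derivedSubspace L).comap J)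
  have d₃ := Submodule.finrank_quotient_add_finrank (derivedSubspace L)
  rw [h.codim_two] at d₃
  have hlt : Module.finrank ℝ (complexCore J) < Module.finrank ℝ (derivedSubspace L) := by
    refine Submodule.finrank_lt_finrank_of_lt (lt_of_le_of_ne inf_le_left fun heq => ?_)
    apply h.non_complex
    rw [IsComplexSubspace, ← hmap]
    exact heq
  obtain ⟨m, hm⟩ := h.even_finrank_complexCore
  have hle := Submodule.finrank_le (derivedSubspace L ⊔ (derivedSubspace L).comap J)
  have hinf : Module.finrank ℝ ↥(derivedSubspace L ⊓ (derivedSubspace L).comap J) = 2 * m := hm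
  have d₄ := Submodule.finrank_sup_add_finrank_inf_eq (complexCore J) (realPart g J)
  have hbot : complexCore J ⊓ realPart g J = ⊥ := by
    rw [eq_bot_iff]
    exact fun x hx => h.eq_zero_of_mem hx.1 hx.2
  have hsup : complexCore J ⊔ realPart g J = derivedSubspace L := by
    refine le_antisymm (sup_le inf_le_left inf_le_left) fun x hx => ?_
    obtain ⟨k, hk, c, hc, rfl⟩ := h.exists_core_add_real hx
    exact Submodule.add_mem_sup hk hc
  rw [hbot, hsup, finrank_bot] at d₄
  refine ⟨by omega, by omega, by omega, Submodule.eq_top_of_finrank_eq (by omega)⟩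

theorem exists_decomposition (h : IsTwoStepSKTNonComplexCodimTwo g J) {n : ℕ}
    (hn : Module.finrank ℝ L = 2 * n) (x : L) :
    ∃ k ∈ complexCore J, ∃ c ∈ realPart g J, ∃ u ∈ realPart g J, k + c + J u = x := by
  obtain ⟨v, hv, y, hy, rfl⟩ := Submodule.mem_sup.mp
    ((h.dimensions hn).2.2.2 ▸ Submodule.mem_top (x := x))
  obtain ⟨k, hk, c, hc, rfl⟩ := h.exists_core_add_real hv
  obtain ⟨k', hk', c', hc', he⟩ := h.exists_core_add_real hy
  refine ⟨k - J k', sub_mem hk (h.J_mem_complexCore hk'), c, hc, -c', neg_mem hc', ?_⟩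
  have : y = -J (k' + c') := by rw [he, h.skt.sq, neg_neg]
  rw [this, map_neg, map_add]
  abel

/-- The orthogonal projection with kernel `𝔞_J`. -/
theorem exists_projection (h : IsTwoStepSKTNonComplexCodimTwo g J) :
    ∃ P : L →ₗ[ℝ] L, (∀ k ∈ complexCore J, P k = 0) ∧ (∀ c ∈ realPart g J, P c = c) ∧
      ∀ x ∈ derivedSubspace L, P x ∈ realPart g J ∧ x - P x ∈ complexCore J := by
  have hc := (h.isCompl_orthogonal (complexCore J)).symm
  have h₁ : ∀ k ∈ complexCore J, Submodule.projection _ _ hc k = 0 := fun k hk =>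
    Submodule.projection_apply_right hc ⟨k, hk⟩
  have h₂ : ∀ c ∈ realPart g J, Submodule.projection _ _ hc c = c := fun c hc' =>
    Submodule.projection_apply_left hc ⟨c, hc'.2⟩
  refine ⟨Submodule.projection _ _ hc, h₁, h₂, fun x hx => ?_⟩
  obtain ⟨k, hk, c, hc', rfl⟩ := h.exists_core_add_real hx
  rw [map_add, h₁ k hk, h₂ c hc', zero_add, add_sub_cancel_right]
  exact ⟨hc', hk⟩

/-- The unit of the algebra `𝔞_r`. -/
theorem exists_unit (h : IsTwoStepSKTNonComplexCodimTwo g J) {n : ℕ}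
    (hn : Module.finrank ℝ L = 2 * n) :
    ∃ E ∈ realPart g J, ∀ c ∈ realPart g J, ⁅J E, c⁆ - c ∈ complexCore J := by
  obtain ⟨P, hPk, hPc, hP⟩ := h.exists_projection
  have hmem : ∀ x y : L, P ⁅x, y⁆ ∈ realPart g J := fun x y =>
    (hP _ (lie_mem_derivedSubspace x y)).1
  let X : Module.Basis (Fin 2) ℝ (realPart g J) :=
    Module.finBasisOfFinrankEq ℝ _ (h.dimensions hn).2.2.1
  let f : realPart g J →ₗ[ℝ] realPart g J →ₗ[ℝ] realPart g J :=
    LinearMap.mk₂ ℝ (fun x y => ⟨P ⁅J x, (y : L)⁆, hmem _ _⟩)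
      (fun x x' y => Subtype.ext (by simp))
      (fun t x y => Subtype.ext (by simp))
      (fun x y y' => Subtype.ext (by simp))
      (fun t x y => Subtype.ext (by simp))
  have hf : ∀ x y, (f x y : L) = P ⁅J x, (y : L)⁆ := fun x y => rfl
  have hsymm : ∀ x y, f x y = f y x := fun x y => Subtype.ext (by
    rw [hf, hf, ← sub_eq_zero, ← map_sub]
    exact hPk _ (h.lie_sub_mem x.2.1 y.2.1))
  have hff : ∀ x y z, (f x (f y z) : L) = P ⁅J x, ⁅J (y : L), (z : L)⁆⁆ := fun x y z => by
    rw [hf, hf, eq_comm, ← sub_eq_zero, ← map_sub, ← lie_sub]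
    exact hPk _ (h.lie_mem_complexCore x.2.1 (hP _ (lie_mem_derivedSubspace _ _)).2)
  have hcomm : ∀ x y z, f x (f y z) = f y (f x z) := fun x y z => Subtype.ext (by
    rw [hff, hff, h.lie_comm _ _ z.2.1])
  obtain ⟨E, hE⟩ := exists_unit_of_span_products X hsymm hcomm fun S hS => by
    have hle : derivedSubspace L ≤ (S.map (realPart g J).subtype).comap P := by
      refine derivedSubspace_le fun x y => ?_
      have key : ∀ u ∈ realPart g J, ∀ k ∈ complexCore J, ∀ c ∈ realPart g J,
          P ⁅J u, k + c⁆ ∈ S.map (realPart g J).subtype := fun u hu k hk c hc => by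
        rw [lie_add, map_add, hPk _ (h.lie_mem_complexCore hu.1 hk), zero_add]
        exact ⟨_, hS ⟨u, hu⟩ ⟨c, hc⟩, rfl⟩
      obtain ⟨k, hk, c, hc, u, hu, rfl⟩ := h.exists_decomposition hn x
      obtain ⟨k', hk', c', hc', u', hu', rfl⟩ := h.exists_decomposition hn y
      have hUU : P ⁅J u, J u'⁆ = 0 := by
        rw [h.lie_J_J hu.1 hu'.1]
        exact hPk _ (h.J_mem_complexCore (h.lie_sub_mem hu.1 hu'.1))
      have hA : ⁅k + c, k' + c'⁆ = 0 :=
        h.lie_eq_zero (add_mem hk.1 hc.1) (add_mem hk'.1 hc'.1)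
      rw [Submodule.mem_comap, add_lie, lie_add, lie_add (J u), hA, zero_add,
        ← lie_skew (k + c) (J u'), map_add, map_add, hUU, add_zero, map_neg]
      exact add_mem (neg_mem (key u' hu' k hk c hc)) (key u hu k' hk' c' hc')
    rw [eq_top_iff]
    intro c _
    obtain ⟨c', hc', he⟩ := hle c.2.1
    rw [hPc _ c.2] at he
    rwa [← Subtype.ext he]
  refine ⟨E, E.2, fun c hc => ?_⟩
  have h₁ : P ⁅J (E : L), c⁆ = c := congrArg Subtype.val (hE ⟨c, hc⟩)
  have h₂ := (hP _ (lie_mem_derivedSubspace (J (E : L)) c)).2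
  rwa [h₁] at h₂

/-- An orthonormal basis `(X₁, X₂)` of `𝔞_r` in which the product is in normal form. -/
theorem exists_real_frame (h : IsTwoStepSKTNonComplexCodimTwo g J) {n : ℕ}
    (hn : Module.finrank ℝ L = 2 * n) :
    ∃ X₁ ∈ realPart g J, ∃ X₂ ∈ realPart g J, ∃ a b₁ b₂ : ℝ, 0 < a ∧ 0 ≤ b₂ ∧
      g X₁ X₁ = 1 ∧ g X₁ X₂ = 0 ∧ g X₂ X₂ = 1 ∧
      (∀ c ∈ realPart g J, ∃ s t : ℝ, c = s • X₁ + t • X₂) ∧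
      ⁅J X₁, X₁⁆ - a • X₁ ∈ complexCore J ∧ ⁅J X₁, X₂⁆ - a • X₂ ∈ complexCore J ∧
      ⁅J X₂, X₂⁆ - (b₁ • X₁ + b₂ • X₂) ∈ complexCore J := by
  obtain ⟨E, hE, hunit⟩ := h.exists_unit hn
  have hdim := (h.dimensions hn).2.2.1
  have normalize : ∀ x ∈ realPart g J, x ≠ 0 → ∃ t : ℝ, 0 < t ∧ g (t • x) (t • x) = 1 := by
    intro x _ hx
    have hp := h.skt.pos x hx
    refine ⟨(√(g x x))⁻¹, by positivity, ?_⟩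
    rw [map_smul, map_smul, LinearMap.smul_apply, smul_eq_mul, smul_eq_mul, ← mul_assoc,
      ← mul_inv, Real.mul_self_sqrt hp.le, inv_mul_cancel₀ hp.ne']
  have hE0 : E ≠ 0 := by
    rintro rfl
    have : realPart g J = ⊥ := by
      rw [eq_bot_iff]
      intro c hc
      have := hunit c hc
      rw [map_zero, zero_lie, zero_sub, neg_mem_iff] at this
      exact h.eq_zero_of_mem this hc
    rw [this, finrank_bot] at hdim
    omega
  obtain ⟨a, ha, hX₁⟩ := normalize E hE hE0
  obtain ⟨X₁, hX₁def⟩ : ∃ X, X = a • E := ⟨_, rfl⟩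
  rw [← hX₁def] at hX₁
  have hX₁m : X₁ ∈ realPart g J := hX₁def ▸ Submodule.smul_mem _ _ hE
  have hX₁0 : X₁ ≠ 0 := hX₁def ▸ smul_ne_zero ha.ne' hE0
  obtain ⟨y, hy, hyX⟩ : ∃ y ∈ realPart g J, y ∉ Submodule.span ℝ {X₁} := by
    by_contra hcon
    push Not at hcon
    have h₁ := Submodule.finrank_mono (show realPart g J ≤ Submodule.span ℝ {X₁} from hcon)
    rw [finrank_span_singleton hX₁0, hdim] at h₁
    omega
  have hy'm : y - g X₁ y • X₁ ∈ realPart g J := sub_mem hy (Submodule.smul_mem _ _ hX₁m)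
  have hy'0 : y - g X₁ y • X₁ ≠ 0 := fun h0 => hyX (by
    rw [sub_eq_zero.mp h0]
    exact Submodule.smul_mem _ _ (Submodule.mem_span_singleton_self _))
  have hy'X : g X₁ (y - g X₁ y • X₁) = 0 := by
    rw [map_sub, map_smul, hX₁, smul_eq_mul, mul_one, sub_self]
  obtain ⟨t, ht, hX₂⟩ := normalize _ hy'm hy'0
  obtain ⟨X₂, hX₂def⟩ : ∃ X, X = t • (y - g X₁ y • X₁) := ⟨_, rfl⟩
  rw [← hX₂def] at hX₂
  have hX₂m : X₂ ∈ realPart g J := hX₂def ▸ Submodule.smul_mem _ _ hy'm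
  have hX₁₂ : g X₁ X₂ = 0 := by rw [hX₂def, map_smul, hy'X, smul_zero]
  have hX₂₁ : g X₂ X₁ = 0 := by rw [h.skt.symm, hX₁₂]
  have hli : LinearIndependent ℝ ![(⟨X₁, hX₁m⟩ : realPart g J), ⟨X₂, hX₂m⟩] := by
    rw [LinearIndependent.pair_iff]
    intro s s' hs
    have hs' : s • X₁ + s' • X₂ = 0 := congrArg Subtype.val hs
    have e₁ := congrArg (g X₁) hs'
    have e₂ := congrArg (g X₂) hs'
    rw [map_add, map_smul, map_smul, hX₁, hX₁₂, map_zero] at e₁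
    rw [map_add, map_smul, map_smul, hX₂₁, hX₂, map_zero] at e₂
    constructor
    · simpa using e₁
    · simpa using e₂
  have hspan : ∀ c ∈ realPart g J, ∃ s t : ℝ, c = s • X₁ + t • X₂ := by
    intro c hc
    obtain ⟨s, s', hs⟩ := exists_coords (basisOfLinearIndependentOfCardEqFinrank hli
      (by rw [hdim, Fintype.card_fin])) ⟨c, hc⟩
    refine ⟨s, s', ?_⟩
    simpa using congrArg Subtype.val hs
  have hunit' : ∀ c ∈ realPart g J, ⁅J X₁, c⁆ - a • c ∈ complexCore J := fun c hc => by
    rw [hX₁def, map_smul, smul_lie, ← smul_sub]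
    exact Submodule.smul_mem _ _ (hunit c hc)
  obtain ⟨k, hk, c, hc, hkc⟩ := h.exists_core_add_real (lie_mem_derivedSubspace (J X₂) X₂)
  obtain ⟨b₁, b₂, rfl⟩ := hspan c hc
  have hb : ⁅J X₂, X₂⁆ - (b₁ • X₁ + b₂ • X₂) ∈ complexCore J := by
    rwa [← hkc, add_sub_cancel_right]
  rcases le_total 0 b₂ with hb₂ | hb₂
  · exact ⟨X₁, hX₁m, X₂, hX₂m, a, b₁, b₂, ha, hb₂, hX₁, hX₁₂, hX₂, hspan, hunit' _ hX₁m,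
      hunit' _ hX₂m, hb⟩
  · refine ⟨X₁, hX₁m, -X₂, neg_mem hX₂m, a, b₁, -b₂, ha, by linarith, hX₁, by simp [hX₁₂],
      by simp [hX₂], fun c hc => ?_, hunit' _ hX₁m, hunit' _ (neg_mem hX₂m), by simpa using hb⟩
    obtain ⟨s, t, rfl⟩ := hspan c hc
    exact ⟨s, -t, by simp⟩

end IsTwoStepSKTNonComplexCodimTwo

end Structure

end SKT

namespace SKT

section Structure

variable {L : Type*} [LieRing L] [LieAlgebra ℝ L]
  {g : LinearMap.BilinForm ℝ L} {J : L →ₗ[ℝ] L}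

namespace IsTwoStepSKTNonComplexCodimTwo

theorem torsionForm_core (h : IsTwoStepSKTNonComplexCodimTwo g J) {u y y' : L}
    (hu : u ∈ derivedSubspace L) (hy : y ∈ complexCore J) (hy' : y' ∈ complexCore J) :
    torsionForm g J u (J y) y' = -(g ⁅J u, y⁆ y' + g ⁅J u, y'⁆ y) := by
  rw [torsionForm_eq h.skt.orthogonal, h.skt.sq, ← lie_skew (J y') (J u), h.lie_J_core hu hy',
    neg_lie, h.lie_eq_zero hy.1 hy'.2, lie_neg]
  simp only [map_neg, LinearMap.neg_apply, h.skt.orthogonal, neg_zero, map_zero,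
    LinearMap.zero_apply]
  ring

/-- The relation between the operators `ad(Jx)` on `𝔞_J` given by the closure of the torsion. -/
theorem core_relation (h : IsTwoStepSKTNonComplexCodimTwo g J) {x v c y y' : L}
    (hx : x ∈ derivedSubspace L) (hv : v ∈ derivedSubspace L) (hc : ⁅J x, v⁆ - c ∈ complexCore J)
    (hy : y ∈ complexCore J) (hy' : y' ∈ complexCore J) :
    (g ⁅J c, y⁆ y' + g ⁅J c, y'⁆ y) + (g ⁅J v, ⁅J x, y⁆⁆ y' + g ⁅J v, y'⁆ ⁅J x, y⁆)
      + (g ⁅J v, y⁆ ⁅J x, y'⁆ + g ⁅J v, ⁅J x, y'⁆⁆ y) = 0 := by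
  have hT := h.skt.torsion_closed (J x) v (J y) y'
  have halt := isAlt₃_torsionForm (g := g) (J := J) h.skt.orthogonal
  have h0 : ∀ p q, torsionForm g J 0 p q = 0 := fun p q => by
    have := (halt.head p q).smul 0 0
    simpa using this
  have h₁ := h.lie_mem_complexCore hx hy
  have h₂ := h.lie_mem_complexCore hx hy'
  have hker : ∀ k ∈ complexCore J, ⁅J ⁅J x, v⁆, k⁆ = ⁅J c, k⁆ := fun k hk => by
    rw [← sub_eq_zero, ← sub_lie, ← map_sub]
    exact h.lie_eq_zero hc.2 hk.1
  rw [extDeriv₃, h.lie_eq_zero hv hy.2, h.lie_eq_zero hv hy'.1, h.lie_eq_zero hy.2 hy'.1,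
    h0, h0, h0, h.lie_J_core hx hy, h.torsionForm_core (lie_mem_derivedSubspace _ _) hy hy',
    halt.swap₁ (J _), h.torsionForm_core hv h₁ hy', halt.swap₁ _ v, halt.swap₂ v,
    h.torsionForm_core hv hy h₂, hker y hy, hker y' hy'] at hT
  linarith

end IsTwoStepSKTNonComplexCodimTwo

variable (g J) in
/-- A basis of the Lie algebra adapted to the splitting `𝔞_J ⊕ 𝔞_r ⊕ J𝔞_r`, in which the operators
`ad(JX)` on `𝔞_J` are diagonal and the product on `𝔞_r` is in normal form. -/
structure AdaptedFrame (m : ℕ) where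
  ψ : (Fin m → ℂ) →ₗ[ℝ] L
  X₁ : L
  X₂ : L
  a : ℝ
  b₁ : ℝ
  b₂ : ℝ
  z : Fin m → ℂ
  w : Fin m → ℂ
  ψ_mem : ∀ y, ψ y ∈ complexCore J
  ψ_surj : ∀ k ∈ complexCore J, ∃ y, ψ y = k
  ψ_I : ∀ y, ψ (Complex.I • y) = J (ψ y)
  ψ_metric : ∀ y y', g (ψ y) (ψ y') = Data.innerJ y y'
  ψ_z : ∀ y, ⁅J X₁, ψ y⁆ = ψ fun i => z i * y i
  ψ_w : ∀ y, ⁅J X₂, ψ y⁆ = ψ fun i => w i * y i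
  X₁_mem : X₁ ∈ realPart g J
  X₂_mem : X₂ ∈ realPart g J
  X_span : ∀ c ∈ realPart g J, ∃ s t : ℝ, c = s • X₁ + t • X₂
  X₁_X₁ : g X₁ X₁ = 1
  X₁_X₂ : g X₁ X₂ = 0
  X₂_X₂ : g X₂ X₂ = 1
  a_pos : 0 < a
  b₂_nonneg : 0 ≤ b₂
  lie_X₁_X₁ : ⁅J X₁, X₁⁆ - a • X₁ ∈ complexCore J
  lie_X₁_X₂ : ⁅J X₁, X₂⁆ - a • X₂ ∈ complexCore J
  lie_X₂_X₂ : ⁅J X₂, X₂⁆ - (b₁ • X₁ + b₂ • X₂) ∈ complexCore J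

theorem IsTwoStepSKTNonComplexCodimTwo.exists_adaptedFrame [Module.Finite ℝ L]
    (h : IsTwoStepSKTNonComplexCodimTwo g J) {n : ℕ} (hn : Module.finrank ℝ L = 2 * n) :
    ∃ m, n = m + 2 ∧ Nonempty (AdaptedFrame g J m) := by
  obtain ⟨X₁, hX₁, X₂, hX₂, a, b₁, b₂, ha, hb₂, h₁₁, h₁₂, h₂₂, hspan, hl₁, hl₂, hl₃⟩ :=
    h.exists_real_frame hn
  let ad (x : L) (hx : x ∈ realPart g J) : complexCore J →ₗ[ℝ] complexCore J :=
    ((LieAlgebra.ad ℝ L (J x)) : L →ₗ[ℝ] L).restrict fun k hk => h.lie_mem_complexCore hx.1 hk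
  have had : ∀ x hx k, ((ad x hx k : complexCore J) : L) = ⁅J x, (k : L)⁆ := fun x hx k => rfl
  have hadJ : ∀ x hx (k : complexCore J), ad x hx
      (J.restrict (fun x hx => h.J_mem_complexCore hx) k) =
      J.restrict (fun x hx => h.J_mem_complexCore hx) (ad x hx k) := fun x hx k =>
    Subtype.ext (h.lie_J_core hx.1 k.2)
  obtain ⟨m, φ, z, w, hφJ, hφg, hz, hw⟩ := exists_diagonalizing_coordinates (H := complexCore J)
    (g := g.restrict (complexCore J)) (J := J.restrict fun x hx => h.J_mem_complexCore hx)
    (fun x y => h.skt.symm x y) (fun x hx => h.skt.pos x (by simpa using hx))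
    (fun x => Subtype.ext (h.skt.sq x)) (fun x y => h.skt.orthogonal x y)
    (A := ad X₁ hX₁) (B := ad X₂ hX₂) (hadJ X₁ hX₁) (hadJ X₂ hX₂)
    (fun k => Subtype.ext (h.lie_comm (J X₁) (J X₂) k.2.1)) (a := a) (b₁ := b₁) (b₂ := b₂)
    (fun y y' => by
      have hr := h.core_relation hX₁.1 hX₁.1 hl₁ y.2 y'.2
      change g ⁅J X₁, ⁅J X₁, (y : L)⁆⁆ y' + 2 * g ⁅J X₁, (y : L)⁆ ⁅J X₁, (y' : L)⁆
        + g y ⁅J X₁, ⁅J X₁, (y' : L)⁆⁆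
        + a * (g ⁅J X₁, (y : L)⁆ y' + g y ⁅J X₁, (y' : L)⁆) = 0
      simp only [map_smul, smul_lie, LinearMap.smul_apply, smul_eq_mul] at hr
      rw [h.skt.symm y ⁅J X₁, ⁅J X₁, (y' : L)⁆⁆, h.skt.symm y ⁅J X₁, (y' : L)⁆]
      rw [h.skt.symm ⁅J X₁, (y' : L)⁆ ⁅J X₁, (y : L)⁆] at hr
      linear_combination hr)
    (fun y y' => by
      have hr := h.core_relation hX₂.1 hX₂.1 hl₃ y.2 y'.2
      change g ⁅J X₂, ⁅J X₂, (y : L)⁆⁆ y' + 2 * g ⁅J X₂, (y : L)⁆ ⁅J X₂, (y' : L)⁆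
        + g y ⁅J X₂, ⁅J X₂, (y' : L)⁆⁆
        + b₁ * (g ⁅J X₁, (y : L)⁆ y' + g y ⁅J X₁, (y' : L)⁆)
        + b₂ * (g ⁅J X₂, (y : L)⁆ y' + g y ⁅J X₂, (y' : L)⁆) = 0
      simp only [map_smul, map_add, add_lie, smul_lie, LinearMap.add_apply, LinearMap.smul_apply,
        smul_eq_mul] at hr
      rw [h.skt.symm y ⁅J X₂, ⁅J X₂, (y' : L)⁆⁆, h.skt.symm y ⁅J X₁, (y' : L)⁆,
        h.skt.symm y ⁅J X₂, (y' : L)⁆]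
      rw [h.skt.symm ⁅J X₂, (y' : L)⁆ ⁅J X₂, (y : L)⁆] at hr
      linear_combination hr)
  have hm : n = m + 2 := by
    have h₁ := (h.dimensions hn).2.1
    have h₂ := (h.dimensions hn).1
    rw [φ.finrank_eq, ← Module.finrank_mul_finrank ℝ ℂ, Complex.finrank_real_complex,
      Module.finrank_fin_fun] at h₁
    omega
  have hdiag : ∀ (x : L) (hx : x ∈ realPart g J) (c : Fin m → ℂ),
      (∀ k i, φ (ad x hx k) i = c i * φ k i) → ∀ y, ⁅J x, (φ.symm y : L)⁆ =
        (φ.symm fun i => c i * y i : complexCore J) := by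
    intro x hx c hc y
    rw [← had x hx]
    congr 1
    rw [LinearEquiv.eq_symm_apply]
    ext i
    rw [hc, LinearEquiv.apply_symm_apply]
  refine ⟨m, hm, ⟨{
    ψ := (complexCore J).subtype ∘ₗ φ.symm.toLinearMap
    X₁ := X₁, X₂ := X₂, a := a, b₁ := b₁, b₂ := b₂, z := z, w := w
    ψ_mem := fun y => (φ.symm y).2
    ψ_surj := fun k hk => ⟨φ ⟨k, hk⟩, by simp⟩
    ψ_I := fun y => ?_
    ψ_metric := fun y y' => ?_
    ψ_z := hdiag X₁ hX₁ z hz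
    ψ_w := hdiag X₂ hX₂ w hw
    X₁_mem := hX₁, X₂_mem := hX₂, X_span := hspan, X₁_X₁ := h₁₁, X₁_X₂ := h₁₂, X₂_X₂ := h₂₂
    a_pos := ha, b₂_nonneg := hb₂, lie_X₁_X₁ := hl₁, lie_X₁_X₂ := hl₂, lie_X₂_X₂ := hl₃ }⟩⟩
  · have : φ.symm (Complex.I • y) =
        J.restrict (fun x hx => h.J_mem_complexCore hx) (φ.symm y) := by
      rw [LinearEquiv.symm_apply_eq, hφJ, LinearEquiv.apply_symm_apply]
    exact congrArg Subtype.val this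
  · have := hφg (φ.symm y) (φ.symm y')
    rw [LinearEquiv.apply_symm_apply, LinearEquiv.apply_symm_apply] at this
    exact this

end Structure

end SKT

namespace SKT

section Structure

variable {L : Type*} [LieRing L] [LieAlgebra ℝ L]
  {g : LinearMap.BilinForm ℝ L} {J : L →ₗ[ℝ] L} {m : ℕ}

theorem extDeriv_torsionForm_map {L' : Type*} [LieRing L'] [LieAlgebra ℝ L']
    {g' : LinearMap.BilinForm ℝ L'} {J' : L' →ₗ[ℝ] L'} (e : L ≃ₗ⁅ℝ⁆ L')
    (hg : ∀ x y, g' (e x) (e y) = g x y) (hJ : ∀ x, e (J x) = J' (e x)) (x y z w : L) :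
    extDeriv₃ (torsionForm g' J') (e x) (e y) (e z) (e w) =
      extDeriv₃ (torsionForm g J) x y z w := by
  have hc : ∀ x y z, torsionForm g' J' (e x) (e y) (e z) = torsionForm g J x y z :=
    fun x y z => by
      simp only [torsionForm, extDeriv₂, fundamentalForm, ← hJ, ← LieEquiv.map_lie, hg]
  simp only [extDeriv₃, ← LieEquiv.map_lie, hc]

theorem IsTwoStepSKTNonComplexCodimTwo.apply_J_right (h : IsTwoStepSKTNonComplexCodimTwo g J)
    (x y : L) : g x (J y) = -g (J x) y := by
  rw [← h.skt.orthogonal x, h.skt.sq, map_neg]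

namespace AdaptedFrame

/-- The parametrization of `𝔞_r` by the basis `(X₁, X₂)`. -/
noncomputable def κ (F : AdaptedFrame g J m) : (Fin 2 → ℝ) →ₗ[ℝ] L :=
  (LinearMap.proj 0).smulRight F.X₁ + (LinearMap.proj 1).smulRight F.X₂

/-- The parametrization of the Lie algebra by the splitting `𝔞_J ⊕ 𝔞_r ⊕ J𝔞_r`. -/
noncomputable def ι (F : AdaptedFrame g J m) : Space m (Fin 2 → ℝ) →ₗ[ℝ] L :=
  F.ψ.coprod (F.κ.coprod (J ∘ₗ F.κ))

variable (F : AdaptedFrame g J m)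

theorem κ_apply (v : Fin 2 → ℝ) : F.κ v = v 0 • F.X₁ + v 1 • F.X₂ := rfl

theorem ι_apply (y : Fin m → ℂ) (v u : Fin 2 → ℝ) :
    F.ι (y, v, u) = F.ψ y + (F.κ v + J (F.κ u)) := rfl

theorem κ_mem (v : Fin 2 → ℝ) : F.κ v ∈ realPart g J :=
  add_mem (Submodule.smul_mem _ _ F.X₁_mem) (Submodule.smul_mem _ _ F.X₂_mem)

theorem κ_injective (h : IsTwoStepSKTNonComplexCodimTwo g J) {v : Fin 2 → ℝ} (hv : F.κ v = 0) :
    v = 0 := by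
  have h₂₁ : g F.X₂ F.X₁ = 0 := by rw [h.skt.symm, F.X₁_X₂]
  have e₁ := congrArg (g F.X₁) hv
  have e₂ := congrArg (g F.X₂) hv
  rw [κ_apply, map_add, map_smul, map_smul, F.X₁_X₁, F.X₁_X₂, map_zero] at e₁
  rw [κ_apply, map_add, map_smul, map_smul, h₂₁, F.X₂_X₂, map_zero] at e₂
  ext j
  fin_cases j
  · simpa using e₁
  · simpa using e₂

theorem ψ_injective {y : Fin m → ℂ} (hy : F.ψ y = 0) : y = 0 := by
  by_contra hne
  have := F.ψ_metric y y
  rw [hy, map_zero] at this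
  exact (Data.innerJ_self_pos hne).ne this

theorem κ_eq_of_sub_mem (h : IsTwoStepSKTNonComplexCodimTwo g J) {v v' : Fin 2 → ℝ}
    (hv : F.κ v - F.κ v' ∈ complexCore J) : v = v' := by
  rw [← map_sub] at hv
  exact sub_eq_zero.mp (F.κ_injective h (h.eq_zero_of_mem hv (F.κ_mem _)))

theorem eq_zero_of_J_κ_mem (h : IsTwoStepSKTNonComplexCodimTwo g J) {u : Fin 2 → ℝ}
    (hu : J (F.κ u) ∈ derivedSubspace L) : u = 0 :=
  F.κ_injective h (h.eq_zero_of_mem ⟨(F.κ_mem u).1, hu⟩ (F.κ_mem u))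

theorem ι_mem_derived (h : IsTwoStepSKTNonComplexCodimTwo g J) {p : Space m (Fin 2 → ℝ)}
    (hp : F.ι p ∈ derivedSubspace L) : p.2.2 = 0 := by
  obtain ⟨y, v, u⟩ := p
  rw [ι_apply, Submodule.add_mem_iff_right _ (F.ψ_mem y).1,
    Submodule.add_mem_iff_right _ (F.κ_mem v).1] at hp
  exact F.eq_zero_of_J_κ_mem h hp

theorem ι_injective (h : IsTwoStepSKTNonComplexCodimTwo g J) : Function.Injective F.ι := by
  rw [injective_iff_map_eq_zero]
  rintro ⟨y, v, u⟩ hp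
  have hu : u = 0 := F.ι_mem_derived h (p := (y, v, u)) (by rw [hp]; exact zero_mem _)
  subst hu
  rw [ι_apply, map_zero, map_zero, add_zero] at hp
  have hv : v = 0 := F.κ_eq_of_sub_mem h (by
    rw [map_zero, sub_zero, ← neg_mem_iff, ← eq_neg_of_add_eq_zero_left hp]
    exact F.ψ_mem y)
  subst hv
  rw [map_zero, add_zero] at hp
  rw [F.ψ_injective hp]
  rfl

theorem exists_κ {c : L} (hc : c ∈ realPart g J) : ∃ v, F.κ v = c := by
  obtain ⟨s, t, rfl⟩ := F.X_span c hc
  exact ⟨![s, t], rfl⟩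

theorem ι_spaceI (h : IsTwoStepSKTNonComplexCodimTwo g J) (p : Space m (Fin 2 → ℝ)) :
    F.ι (Data.spaceI m _ p) = J (F.ι p) := by
  obtain ⟨y, v, u⟩ := p
  change F.ι (Complex.I • y, -u, v) = _
  rw [ι_apply, ι_apply, F.ψ_I, map_add, map_add, h.skt.sq, map_neg]
  abel

variable [Module.Finite ℝ L] {n : ℕ}

theorem ι_surjective (h : IsTwoStepSKTNonComplexCodimTwo g J)
    (hn : Module.finrank ℝ L = 2 * n) : Function.Surjective F.ι := by
  intro x
  obtain ⟨k, hk, c, hc, u, hu, rfl⟩ := h.exists_decomposition hn x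
  obtain ⟨y, rfl⟩ := F.ψ_surj k hk
  obtain ⟨v, rfl⟩ := F.exists_κ hc
  obtain ⟨v', rfl⟩ := F.exists_κ hu
  exact ⟨(y, v, v'), by rw [ι_apply, add_assoc]⟩

/-- The linear isomorphism between the model space and the Lie algebra. -/
noncomputable def equiv (h : IsTwoStepSKTNonComplexCodimTwo g J)
    (hn : Module.finrank ℝ L = 2 * n) : Space m (Fin 2 → ℝ) ≃ₗ[ℝ] L :=
  LinearEquiv.ofBijective F.ι ⟨F.ι_injective h, F.ι_surjective h hn⟩

/-- The components of the bracket `[JX, W]` for `X, W` in `𝔞_r`. -/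
noncomputable def product (h : IsTwoStepSKTNonComplexCodimTwo g J)
    (hn : Module.finrank ℝ L = 2 * n) :
    (Fin 2 → ℝ) →ₗ[ℝ] (Fin 2 → ℝ) →ₗ[ℝ] Space m (Fin 2 → ℝ) :=
  LinearMap.mk₂ ℝ (fun u v => (F.equiv h hn).symm ⁅J (F.κ u), F.κ v⁆)
    (fun _ _ _ => by simp) (fun _ _ _ => by simp) (fun _ _ _ => by simp) (fun _ _ _ => by simp)

variable (h : IsTwoStepSKTNonComplexCodimTwo g J) (hn : Module.finrank ℝ L = 2 * n)

theorem lie_J_κ_κ (u v : Fin 2 → ℝ) :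
    ⁅J (F.κ u), F.κ v⁆ = F.ψ (F.product h hn u v).1 + F.κ (F.product h hn u v).2.1 := by
  have h₁ : F.ι (F.product h hn u v) = ⁅J (F.κ u), F.κ v⁆ :=
    (F.equiv h hn).apply_symm_apply ⁅J (F.κ u), F.κ v⁆
  have h₂ : (F.product h hn u v).2.2 = 0 :=
    F.ι_mem_derived h (by rw [h₁]; exact lie_mem_derivedSubspace _ _)
  rw [← h₁]
  generalize F.product h hn u v = p at *
  obtain ⟨y, x, x'⟩ := p
  change x' = 0 at h₂
  rw [h₂, ι_apply, map_zero, map_zero, add_zero]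

theorem product_eq_of_sub_mem {u v x : Fin 2 → ℝ}
    (hx : ⁅J (F.κ u), F.κ v⁆ - F.κ x ∈ complexCore J) : (F.product h hn u v).2.1 = x := by
  refine F.κ_eq_of_sub_mem h ?_
  rw [F.lie_J_κ_κ h hn, add_sub_assoc, Submodule.add_mem_iff_right _ (F.ψ_mem _)] at hx
  exact hx

theorem lie_sub_κ_mem (u v : Fin 2 → ℝ) :
    ⁅J (F.κ u), F.κ v⁆ - F.κ (F.product h hn u v).2.1 ∈ complexCore J := by
  rw [F.lie_J_κ_κ h hn, add_sub_cancel_right]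
  exact F.ψ_mem _

theorem product_symm (u v : Fin 2 → ℝ) :
    (F.product h hn u v).2.1 = (F.product h hn v u).2.1 := by
  refine F.product_eq_of_sub_mem h hn ?_
  rw [← sub_add_sub_cancel _ ⁅J (F.κ v), F.κ u⁆]
  exact add_mem (h.lie_sub_mem (F.κ_mem u).1 (F.κ_mem v).1) (F.lie_sub_κ_mem h hn v u)

theorem product_comm (u v x : Fin 2 → ℝ) :
    (F.product h hn u (F.product h hn v x).2.1).2.1 =
      (F.product h hn v (F.product h hn u x).2.1).2.1 := by
  have key : ∀ u v, ⁅J (F.κ u), ⁅J (F.κ v), F.κ x⁆⁆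
      - ⁅J (F.κ u), F.κ (F.product h hn v x).2.1⁆ ∈ complexCore J := fun u v => by
    rw [← lie_sub]
    exact h.lie_mem_complexCore (F.κ_mem u).1 (F.lie_sub_κ_mem h hn v x)
  refine F.product_eq_of_sub_mem h hn ?_
  have h₁ := sub_mem (key v u) (key u v)
  rw [h.lie_comm _ _ (F.κ_mem x).1] at h₁
  have h₂ := add_mem h₁ (F.lie_sub_κ_mem h hn v (F.product h hn u x).2.1)
  convert h₂ using 1
  abel

/-- The data `(f, h, α)` of the Lie algebra in an adapted frame. -/
noncomputable def toData : Data m (Fin 2 → ℝ) where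
  f := (F.product h hn).compr₂ (LinearMap.fst ℝ _ _ ∘ₗ LinearMap.snd ℝ _ _)
  h := (F.product h hn).compr₂ (LinearMap.fst ℝ _ _)
  α i := (LinearMap.proj 0).smulRight (F.z i) + (LinearMap.proj 1).smulRight (F.w i)
  g₀ := g.compl₁₂ F.κ F.κ
  τ₀ := g.compl₁₂ (J ∘ₗ F.κ) F.κ
  f_symm := F.product_symm h hn
  f_f_symm x y z := by
    change (F.product h hn (F.product h hn x y).2.1 z).2.1 =
      (F.product h hn (F.product h hn x z).2.1 y).2.1
    rw [F.product_symm h hn _ z, F.product_symm h hn x y, F.product_comm h hn,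
      F.product_symm h hn z x, F.product_symm h hn y]
  g₀_symm x y := h.skt.symm _ _
  τ₀_skew x y := by
    change g (J (F.κ x)) (F.κ y) = -g (J (F.κ y)) (F.κ x)
    rw [← h.apply_J_right, h.skt.symm]
  pos x u hxu := by
    have hne : F.ι (0, x, u) ≠ 0 := fun h0 => by
      have := F.ι_injective h (h0.trans (map_zero F.ι).symm)
      simp only [Prod.mk_eq_zero] at this
      rcases hxu with hx | hu
      · exact hx this.2.1
      · exact hu this.2.2
    have hp := h.skt.pos _ hne
    rw [ι_apply, map_zero, zero_add] at hp
    simp only [map_add, LinearMap.add_apply, h.skt.orthogonal] at hp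
    rw [h.skt.symm (F.κ x) (J (F.κ u))] at hp
    change 0 < g (F.κ x) (F.κ x) + g (F.κ u) (F.κ u) + 2 * g (J (F.κ u)) (F.κ x)
    linarith

theorem lie_J_κ_ψ (u : Fin 2 → ℝ) (y : Fin m → ℂ) :
    ⁅J (F.κ u), F.ψ y⁆ = F.ψ fun i => (F.toData h hn).α i u * y i := by
  rw [κ_apply, map_add, map_smul, map_smul, add_lie, smul_lie, smul_lie, F.ψ_z, F.ψ_w, ← map_smul,
    ← map_smul, ← map_add]
  congr 1
  ext i
  simp [toData]
  ring

theorem ι_bracket (p q : Space m (Fin 2 → ℝ)) :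
    F.ι ((F.toData h hn).bracket p q) = ⁅F.ι p, F.ι q⁆ := by
  obtain ⟨y, v, u⟩ := p
  obtain ⟨y', v', u'⟩ := q
  have hRR : ⁅F.ψ y + F.κ v, F.ψ y' + F.κ v'⁆ = 0 :=
    h.lie_eq_zero (add_mem (F.ψ_mem y).1 (F.κ_mem v).1) (add_mem (F.ψ_mem y').1 (F.κ_mem v').1)
  have hUU : ⁅J (F.κ u), J (F.κ u')⁆ = F.ψ (Complex.I •
      ((F.toData h hn).h u u' - (F.toData h hn).h u' u)) := by
    rw [h.lie_J_J (F.κ_mem u).1 (F.κ_mem u').1, F.lie_J_κ_κ h hn, F.lie_J_κ_κ h hn,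
      F.product_symm h hn u u', F.ψ_I, add_sub_add_right_eq_sub, ← map_sub]
    rfl
  rw [ι_apply F y v u, ι_apply F y' v' u', ← add_assoc, ← add_assoc, add_lie, lie_add,
    lie_add (J (F.κ u)), hRR, hUU, zero_add, ← lie_skew _ (J (F.κ u')), lie_add, lie_add, F.lie_J_κ_ψ h hn, F.lie_J_κ_ψ h hn,
    F.lie_J_κ_κ h hn, F.lie_J_κ_κ h hn]
  change F.ι (_, (F.product h hn u v').2.1 - (F.product h hn u' v).2.1, 0) = _
  rw [ι_apply, map_zero, map_zero, add_zero, map_sub]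
  have hψ : (fun i => (F.toData h hn).α i u * y' i - (F.toData h hn).α i u' * y i
      + (F.toData h hn).h u v' i - (F.toData h hn).h u' v i
      + 2 * Complex.I * (F.toData h hn).h₂ u u' i) =
      (fun i => (F.toData h hn).α i u * y' i) - (fun i => (F.toData h hn).α i u' * y i)
      + (F.product h hn u v').1 - (F.product h hn u' v).1
      + Complex.I • ((F.toData h hn).h u u' - (F.toData h hn).h u' u) := by
    ext i
    simp only [Data.h₂, Pi.add_apply, Pi.sub_apply, Pi.smul_apply, smul_eq_mul]
    change _ = _ - _ + (F.toData h hn).h u v' i - (F.toData h hn).h u' v i + _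
    ring
  change F.ψ (fun i => (F.toData h hn).α i u * y' i - (F.toData h hn).α i u' * y i
      + (F.toData h hn).h u v' i - (F.toData h hn).h u' v i
      + 2 * Complex.I * (F.toData h hn).h₂ u u' i) + _ = _
  rw [hψ]
  simp only [map_add, map_sub]
  abel

theorem ι_metric (p q : Space m (Fin 2 → ℝ)) :
    (F.toData h hn).spaceMetric p q = g (F.ι p) (F.ι q) := by
  obtain ⟨y, v, u⟩ := p
  obtain ⟨y', v', u'⟩ := q
  have h₁ : ∀ y v, g (F.ψ y) (F.κ v) = 0 := fun y v => (F.κ_mem v).2 _ (F.ψ_mem y)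
  have h₂ : ∀ y v, g (F.ψ y) (J (F.κ v)) = 0 := fun y v => by
    rw [h.apply_J_right, ← F.ψ_I, h₁, neg_zero]
  have h₃ : ∀ y v, g (F.κ v) (F.ψ y) = 0 := fun y v => by rw [h.skt.symm, h₁]
  have h₄ : ∀ y v, g (J (F.κ v)) (F.ψ y) = 0 := fun y v => by rw [h.skt.symm, h₂]
  rw [ι_apply, ι_apply]
  simp only [map_add, LinearMap.add_apply, h₁, h₂, h₃, h₄, h.skt.orthogonal, F.ψ_metric]
  rw [h.skt.symm (F.κ v) (J (F.κ u'))]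
  change Data.innerJ y y' + g (F.κ v) (F.κ v') + g (F.κ u) (F.κ u') + g (J (F.κ u)) (F.κ v')
    + g (J (F.κ u')) (F.κ v) = _
  ring

theorem jacobi : (F.toData h hn).Jacobi := fun p q r => F.ι_injective h (by
  rw [map_add]
  simp only [F.ι_bracket h hn]
  exact leibniz_lie _ _ _)

/-- The isomorphism between the Lie algebra and its model. -/
noncomputable def lieEquiv : L ≃ₗ⁅ℝ⁆ (F.toData h hn).Model (F.jacobi h hn) :=
  { (F.equiv h hn).symm with
    map_lie' := fun {x y} => by
      change (F.equiv h hn).symm ⁅x, y⁆ =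
        (F.toData h hn).bracket ((F.equiv h hn).symm x) ((F.equiv h hn).symm y)
      rw [LinearEquiv.symm_apply_eq]
      have := F.ι_bracket h hn ((F.equiv h hn).symm x) ((F.equiv h hn).symm y)
      refine Eq.trans ?_ this.symm
      congr 1
      · exact ((F.equiv h hn).apply_symm_apply x).symm
      · exact ((F.equiv h hn).apply_symm_apply y).symm }

theorem ι_lieEquiv (x : L) : F.ι (F.lieEquiv h hn x) = x := (F.equiv h hn).apply_symm_apply x

theorem metric_lieEquiv (x y : L) :
    Data.metric (F.jacobi h hn) (F.lieEquiv h hn x) (F.lieEquiv h hn y) = g x y := by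
  refine (F.ι_metric h hn _ _).trans ?_
  rw [F.ι_lieEquiv h hn, F.ι_lieEquiv h hn]

theorem complexStructure_lieEquiv (x : L) :
    F.lieEquiv h hn (J x) = Data.complexStructure (F.jacobi h hn) (F.lieEquiv h hn x) :=
  F.ι_injective h (by
    rw [F.ι_lieEquiv h hn]
    refine Eq.trans ?_ (F.ι_spaceI h _).symm
    rw [F.ι_lieEquiv h hn])

theorem isNormalForm :
    IsNormalForm (F.toData h hn) (Pi.basisFun ℝ (Fin 2)) F.a F.b₁ F.b₂ F.z F.w := by
  have h₀ : F.κ (Pi.basisFun ℝ (Fin 2) 0) = F.X₁ := by simp [κ_apply]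
  have h₁ : F.κ (Pi.basisFun ℝ (Fin 2) 1) = F.X₂ := by simp [κ_apply]
  refine isNormalForm_of_closed (fun j k => ?_) F.a_pos F.b₂_nonneg (fun j => ?_) ?_ (fun i => ?_)
    (fun i => ?_) (F.jacobi h hn) (fun x₁ x₂ x₃ x₄ => ?_) fun y => ?_
  · change g (F.κ _) (F.κ _) = _
    fin_cases j <;> fin_cases k
    · simp only [Fin.zero_eta, h₀, F.X₁_X₁, if_true]
    · simp only [Fin.zero_eta, Fin.mk_one, h₀, h₁, F.X₁_X₂, zero_ne_one, if_false]
    · simp only [Fin.zero_eta, Fin.mk_one, h₀, h₁, h.skt.symm F.X₂, F.X₁_X₂, one_ne_zero, if_false]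
    · simp only [Fin.mk_one, h₁, F.X₂_X₂, if_true]
  · refine F.product_eq_of_sub_mem h hn ?_
    fin_cases j
    · simpa only [map_smul, Fin.zero_eta, h₀] using F.lie_X₁_X₁
    · simpa only [map_smul, Fin.mk_one, h₀, h₁] using F.lie_X₁_X₂
  · refine F.product_eq_of_sub_mem h hn ?_
    simpa only [map_add, map_smul, h₀, h₁] using F.lie_X₂_X₂
  · simp [toData]
  · simp [toData]
  · let e := F.lieEquiv h hn
    rw [← e.apply_symm_apply x₁, ← e.apply_symm_apply x₂, ← e.apply_symm_apply x₃,
      ← e.apply_symm_apply x₄,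
      extDeriv_torsionForm_map e (F.metric_lieEquiv h hn) (F.complexStructure_lieEquiv h hn)]
    exact h.skt.torsion_closed _ _ _ _
  · have hle : derivedSubspace L ≤ (derivedSubspace ((F.toData h hn).Model (F.jacobi h hn))).comap
        (F.lieEquiv h hn : L →ₗ[ℝ] _) := derivedSubspace_le fun x y => by
      change F.lieEquiv h hn ⁅x, y⁆ ∈ derivedSubspace _
      rw [LieEquiv.map_lie]
      exact lie_mem_derivedSubspace _ _
    have hy : F.lieEquiv h hn (F.ψ y) = Data.ofJ (F.jacobi h hn) y := F.ι_injective h (by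
      rw [F.ι_lieEquiv h hn]
      change _ = F.ι (y, 0, 0)
      simp [ι_apply])
    rw [← hy]
    exact hle (F.ψ_mem y).1

end AdaptedFrame

end Structure

end SKT

theorem mainTheorem4 :
    -- every such algebra of dimension `2n` is some `𝔤_{f,h,α}` in normal form
    (∀ (n : ℕ) (L : Type*) [LieRing L] [LieAlgebra ℝ L] [Module.Finite ℝ L]
        (g : LinearMap.BilinForm ℝ L) (J : L →ₗ[ℝ] L),
        Module.finrank ℝ L = 2 * n →
        SKT.IsTwoStepSKTNonComplexCodimTwo g J →
        ∃ m : ℕ, n = m + 2 ∧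
          ∃ (D : SKT.Data m (Fin 2 → ℝ)) (X : Module.Basis (Fin 2) ℝ (Fin 2 → ℝ))
            (a b₁ b₂ : ℝ) (z w : Fin m → ℂ),
            SKT.IsNormalForm D X a b₁ b₂ z w ∧
            ∃ hJ : D.Jacobi,
              SKT.AreIsomorphic g J (SKT.Data.metric hJ) (SKT.Data.complexStructure hJ)) ∧
    -- conversely, every `𝔤_{f,h,α}` in normal form is such an algebra
    (∀ (m : ℕ) (V : Type*) [AddCommGroup V] [Module ℝ V]
        (D : SKT.Data m V) (X : Module.Basis (Fin 2) ℝ V)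
        (a b₁ b₂ : ℝ) (z w : Fin m → ℂ),
        SKT.IsNormalForm D X a b₁ b₂ z w →
        ∃ hJ : D.Jacobi,
          Module.finrank ℝ (D.Model hJ) = 2 * (m + 2) ∧
          SKT.IsTwoStepSKTNonComplexCodimTwo
            (SKT.Data.metric hJ) (SKT.Data.complexStructure hJ)) ∧
    -- the third case only occurs if `b₁ ≥ -b₂² / (4a)`
    (∀ (m : ℕ) (V : Type*) [AddCommGroup V] [Module ℝ V]
        (D : SKT.Data m V) (X : Module.Basis (Fin 2) ℝ V)
        (a b₁ b₂ : ℝ) (z w : Fin m → ℂ),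
        SKT.IsNormalForm D X a b₁ b₂ z w →
        (∃ i, (z i).re = -a / 2) → b₁ ≥ -b₂ ^ 2 / (4 * a)) := by
  refine ⟨fun n L _ _ _ g J hn h => ?_, fun m V _ _ D X a b₁ b₂ z w hN => ?_,
    fun m V _ _ D X a b₁ b₂ z w hN ⟨i, hi⟩ => hN.le_b₁ hi⟩
  · obtain ⟨m, hm, ⟨F⟩⟩ := h.exists_adaptedFrame hn
    exact ⟨m, hm, F.toData h hn, _, F.a, F.b₁, F.b₂, F.z, F.w, F.isNormalForm h hn,
      F.jacobi h hn, F.lieEquiv h hn, F.metric_lieEquiv h hn, F.complexStructure_lieEquiv h hn⟩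
  · exact ⟨hN.jacobi, SKT.IsNormalForm.finrank_model X _, hN.isTwoStepSKT _⟩
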